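/- Let $M=I_t\times I_x\times I_y\times I_z\subset\mathbb R^4$ be a product of nonempty open intervals (bounded or not) with coordinates $(t,x,y,z)$, let $H,D\in C^\infty(I_x)$ with $D\neq 0$ everywhere and let $S\in C^\infty(I_z)$ be non-constant. Endow $M$ with the Lorentzian metric $$ds^2=[dt+H(x)\,dy]^2-D(x)^2\,dy^2-dx^2-dz^2$$ and with the metric-compatible connection $\Gamma$ whose torsion $T^a{}_{bc}=\Gamma^a{}_{bc}-\Gamma^a{}_{cb}$ has $T^t{}_{xy}=-T^t{}_{yx}=D(x)S(z)$ as its only nonvanishing components. Let $\mathfrak g$ be the Lie algebra of the (local) group of affine-isometric motions of $M$, i.e. the space of all smooth vector fields $\xi$ on $M$ with $\mathcal L_\xi g=0$ and $\mathcal L_\xi\Gamma=0$. The dimension of the group is $\dim\mathfrak g$; the isotropy algebra at $P\in M$ is $\{\xi\in\mathfrak g:\xi(P)=0\}$; the orbit of $P$ is the set of points reachable from $P$ by finitely many successive integral curves, inside $M$, of fields in $\mathfrak g$; and $M$ is called ST homogeneous if the orbit of every point is $M$. 1. (Generic case, $G_2$.) If the functions $H'/D$ and $D''/D$ are not both constant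 on $I_x$, then the group of affine-isometric motions is two-dimensional, and its isotropy algebra at every point is zero. 2. ($G_4$.) If $H'/D=2\omega$ and $D''/D=m^2$ on $I_x$, with real constants $\omega$ and $m^2$ (the constant denoted $m^2$ may have either sign), then the group of affine-isometric motions is four-dimensional, its isotropy algebra at every point $P\in M$ is one-dimensional, and the orbit of every $P$ is the three-dimensional hypersurface $\{Q\in M: z(Q)=z(P)\}$, with three-dimensional tangent space $\{\xi(P):\xi\in\mathfrak g\}$ at $P$. In particular $M$ is not ST homogeneous. -/

import Mathlib

open scoped ContDiff

namespace RiemannCartan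

/-- Coordinate space, with coordinates `(t, x, y, z) = (p 0, p 1, p 2, p 3)`. -/
abbrev Pt : Type := Fin 4 → ℝ

/-- The partial derivative `∂ᵢ f` at `p`. -/
noncomputable def pd (i : Fin 4) (f : Pt → ℝ) (p : Pt) : ℝ :=
  fderiv ℝ f p (Pi.single i 1)

/-- Christoffel symbols `{a; b c}` of the metric `g`. -/
noncomputable def christoffel (g : Pt → Matrix (Fin 4) (Fin 4) ℝ) (p : Pt)
    (a b c : Fin 4) : ℝ :=
  (1 / 2) * ∑ d, (g p)⁻¹ a d *
    (pd b (fun q => g q d c) p + pd c (fun q => g q d b) p - pd d (fun q => g q b c) p)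

/-- The torsion with its first index lowered, `T_{abc} = g_{ae} T^e_{bc}`. -/
noncomputable def lowerTorsion (g : Pt → Matrix (Fin 4) (Fin 4) ℝ)
    (T : Pt → Fin 4 → Fin 4 → Fin 4 → ℝ) (p : Pt) (a b c : Fin 4) : ℝ :=
  ∑ e, g p a e * T p e b c

/-- The contorsion `K^a_{bc} = (1/2) g^{ad} (T_{dbc} - T_{bcd} + T_{cdb})`. -/
noncomputable def contorsion (g : Pt → Matrix (Fin 4) (Fin 4) ℝ)
    (T : Pt → Fin 4 → Fin 4 → Fin 4 → ℝ) (p : Pt) (a b c : Fin 4) : ℝ :=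
  (1 / 2) * ∑ d, (g p)⁻¹ a d *
    (lowerTorsion g T p d b c - lowerTorsion g T p b c d + lowerTorsion g T p c d b)

/-- The coefficients `Γ^a_{bc}` of the metric-compatible connection with torsion
`T^a_{bc} = Γ^a_{bc} - Γ^a_{cb}`, with the convention `∇_b ∂_c = Γ^a_{bc} ∂_a`. -/
noncomputable def connection (g : Pt → Matrix (Fin 4) (Fin 4) ℝ)
    (T : Pt → Fin 4 → Fin 4 → Fin 4 → ℝ) (p : Pt) (a b c : Fin 4) : ℝ :=
  christoffel g p a b c + contorsion g T p a b c

/-- The Lie derivative `(L_ξ g)_{ab}` of the metric. -/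
noncomputable def lieMetric (g : Pt → Matrix (Fin 4) (Fin 4) ℝ) (ξ : Pt → Pt) (p : Pt)
    (a b : Fin 4) : ℝ :=
  ∑ d, (ξ p d * pd d (fun q => g q a b) p
    + g p d b * pd a (fun q => ξ q d) p
    + g p a d * pd b (fun q => ξ q d) p)

/-- The Lie derivative `(L_ξ Γ)^a_{bc}` of the connection. -/
noncomputable def lieConnection (Γ : Pt → Fin 4 → Fin 4 → Fin 4 → ℝ) (ξ : Pt → Pt) (p : Pt)
    (a b c : Fin 4) : ℝ :=
  pd b (pd c (fun q => ξ q a)) p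
    + ∑ d, (ξ p d * pd d (fun q => Γ q a b c) p
      - Γ p d b c * pd d (fun q => ξ q a) p
      + Γ p a d c * pd b (fun q => ξ q d) p
      + Γ p a b d * pd c (fun q => ξ q d) p)

/-- Smooth vector fields on `M` preserving the metric (isometry) and the connection (affine
collineation). A field on `M` is represented by its extension by zero to the coordinate space. -/
def IsAffineIsometric (M : Set Pt) (g : Pt → Matrix (Fin 4) (Fin 4) ℝ)
    (Γ : Pt → Fin 4 → Fin 4 → Fin 4 → ℝ) (ξ : Pt → Pt) : Prop :=
  (∀ p ∉ M, ξ p = 0) ∧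
  (∀ p ∈ M, ContDiffAt ℝ ∞ ξ p) ∧
  (∀ p ∈ M, ∀ a b, lieMetric g ξ p a b = 0) ∧
  (∀ p ∈ M, ∀ a b c, lieConnection Γ ξ p a b c = 0)

theorem contDiffAt_component {ξ : Pt → Pt} {p : Pt} (h : ContDiffAt ℝ ∞ ξ p) (a : Fin 4) :
    ContDiffAt ℝ ∞ (fun q => ξ q a) p :=
  contDiffAt_pi.1 h a

theorem pd_add {f h : Pt → ℝ} {p : Pt} (i : Fin 4) (hf : ContDiffAt ℝ ∞ f p)
    (hh : ContDiffAt ℝ ∞ h p) :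
    pd i (fun q => f q + h q) p = pd i f p + pd i h p := by
  unfold pd
  rw [fderiv_fun_add (hf.differentiableAt (by simp)) (hh.differentiableAt (by simp))]
  rfl

theorem pd_smul {f : Pt → ℝ} {p : Pt} (i : Fin 4) (r : ℝ) (hf : ContDiffAt ℝ ∞ f p) :
    pd i (fun q => r * f q) p = r * pd i f p := by
  unfold pd
  rw [fderiv_const_mul (hf.differentiableAt (by simp))]
  rfl

theorem contDiffAt_pd {f : Pt → ℝ} {p : Pt} (i : Fin 4) (hf : ContDiffAt ℝ ∞ f p) :
    ContDiffAt ℝ ∞ (pd i f) p := by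
  have h : ContDiffAt ℝ ∞ (fderiv ℝ f) p := hf.fderiv_right (by simp)
  exact h.clm_apply contDiffAt_const

theorem eventually_differentiableAt {f : Pt → ℝ} {p : Pt} (hf : ContDiffAt ℝ ∞ f p) :
    ∀ᶠ q in nhds p, DifferentiableAt ℝ f q := by
  have h1 : ContDiffAt ℝ 1 f p := hf.of_le (by exact_mod_cast le_top)
  filter_upwards [h1.eventually (by simp)] with q hq
  exact hq.differentiableAt (by simp)

theorem pd_pd_add {f h : Pt → ℝ} {p : Pt} (i j : Fin 4) (hf : ContDiffAt ℝ ∞ f p)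
    (hh : ContDiffAt ℝ ∞ h p) :
    pd i (pd j (fun q => f q + h q)) p = pd i (pd j f) p + pd i (pd j h) p := by
  rw [← pd_add i (contDiffAt_pd j hf) (contDiffAt_pd j hh)]
  have : pd j (fun q => f q + h q) =ᶠ[nhds p] fun q => pd j f q + pd j h q := by
    filter_upwards [eventually_differentiableAt hf, eventually_differentiableAt hh] with q h1 h2
    unfold pd
    rw [fderiv_fun_add h1 h2]
    rfl
  conv_lhs => unfold pd
  conv_rhs => unfold pd
  exact congrArg (fun L : Pt →L[ℝ] ℝ => L (Pi.single i 1)) this.fderiv_eq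

theorem pd_pd_smul {f : Pt → ℝ} {p : Pt} (i j : Fin 4) (r : ℝ) (hf : ContDiffAt ℝ ∞ f p) :
    pd i (pd j (fun q => r * f q)) p = r * pd i (pd j f) p := by
  rw [← pd_smul i r (contDiffAt_pd j hf)]
  have : pd j (fun q => r * f q) =ᶠ[nhds p] fun q => r * pd j f q := by
    filter_upwards [eventually_differentiableAt hf] with q h1
    unfold pd
    rw [fderiv_const_mul h1]
    rfl
  conv_lhs => unfold pd
  conv_rhs => unfold pd
  exact congrArg (fun L : Pt →L[ℝ] ℝ => L (Pi.single i 1)) this.fderiv_eq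

/-- The Lie algebra (as a real vector space) of the group of affine-isometric motions of
`(M, g, Γ)`. Its dimension is the dimension of the group. -/
def motions (M : Set Pt) (g : Pt → Matrix (Fin 4) (Fin 4) ℝ)
    (Γ : Pt → Fin 4 → Fin 4 → Fin 4 → ℝ) : Submodule ℝ (Pt → Pt) where
  carrier := {ξ | IsAffineIsometric M g Γ ξ}
  zero_mem' := by
    refine ⟨fun _ _ => rfl, fun _ _ => contDiffAt_const, ?_, ?_⟩
    · intro p _ a b
      simp [lieMetric, pd]
    · intro p _ a b c
      have h : pd c (fun _ : Pt => (0 : ℝ)) = fun _ => 0 := by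
        funext q
        simp [pd]
      have h' : pd b (fun _ : Pt => (0 : ℝ)) p = 0 := by simp [pd]
      simp only [lieConnection, Pi.zero_apply, h, h']
      simp [pd]
  add_mem' := by
    rintro ξ η ⟨h1, h2, h3, h4⟩ ⟨k1, k2, k3, k4⟩
    refine ⟨fun p hp => by simp [h1 p hp, k1 p hp],
      fun p hp => (h2 p hp).add (k2 p hp), ?_, ?_⟩
    · intro p hp a b
      have e : lieMetric g (ξ + η) p a b = lieMetric g ξ p a b + lieMetric g η p a b := by
        simp only [lieMetric, Pi.add_apply,
          pd_add _ (contDiffAt_component (h2 p hp) _) (contDiffAt_component (k2 p hp) _)]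
        rw [← Finset.sum_add_distrib]
        refine Finset.sum_congr rfl fun d _ => ?_
        ring
      rw [e, h3 p hp, k3 p hp, add_zero]
    · intro p hp a b c
      have e : lieConnection Γ (ξ + η) p a b c
          = lieConnection Γ ξ p a b c + lieConnection Γ η p a b c := by
        simp only [lieConnection, Pi.add_apply,
          pd_add _ (contDiffAt_component (h2 p hp) _) (contDiffAt_component (k2 p hp) _),
          pd_pd_add _ _ (contDiffAt_component (h2 p hp) _) (contDiffAt_component (k2 p hp) _)]
        rw [add_add_add_comm, ← Finset.sum_add_distrib]
        congr 1
        refine Finset.sum_congr rfl fun d _ => ?_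
        ring
      rw [e, h4 p hp, k4 p hp, add_zero]
  smul_mem' := by
    rintro r ξ ⟨h1, h2, h3, h4⟩
    refine ⟨fun p hp => by simp [h1 p hp], fun p hp => contDiffAt_const.smul (h2 p hp), ?_, ?_⟩
    · intro p hp a b
      have e : lieMetric g (r • ξ) p a b = r * lieMetric g ξ p a b := by
        simp only [lieMetric, Pi.smul_apply, smul_eq_mul,
          pd_smul _ r (contDiffAt_component (h2 p hp) _)]
        rw [Finset.mul_sum]
        refine Finset.sum_congr rfl fun d _ => ?_
        ring
      rw [e, h3 p hp, mul_zero]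
    · intro p hp a b c
      have e : lieConnection Γ (r • ξ) p a b c = r * lieConnection Γ ξ p a b c := by
        simp only [lieConnection, Pi.smul_apply, smul_eq_mul,
          pd_smul _ r (contDiffAt_component (h2 p hp) _),
          pd_pd_smul _ _ r (contDiffAt_component (h2 p hp) _)]
        rw [mul_add, Finset.mul_sum]
        congr 1
        refine Finset.sum_congr rfl fun d _ => ?_
        ring
      rw [e, h4 p hp, mul_zero]

/-- The isotropy algebra at `P`: the motions that fix `P`. -/
def isotropy (G : Submodule ℝ (Pt → Pt)) (P : Pt) : Submodule ℝ (Pt → Pt) :=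
  G ⊓ LinearMap.ker (LinearMap.proj (R := ℝ) (φ := fun _ : Pt => Pt) P)

/-- The tangent space at `P` of the orbit of `P`: all values `ξ P` of motions `ξ`. -/
def orbitTangent (G : Submodule ℝ (Pt → Pt)) (P : Pt) : Submodule ℝ Pt :=
  G.map (LinearMap.proj (R := ℝ) (φ := fun _ : Pt => Pt) P)

/-- One of the local one-parameter groups of motions carries `p` to `q` inside `M`. -/
def FlowsTo (M : Set Pt) (G : Submodule ℝ (Pt → Pt)) (p q : Pt) : Prop :=
  ∃ ξ ∈ G, ∃ γ : ℝ → Pt, γ 0 = p ∧ γ 1 = q ∧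
    ∀ s ∈ Set.Icc (0 : ℝ) 1, γ s ∈ M ∧
      HasDerivWithinAt γ (ξ (γ s)) (Set.Icc (0 : ℝ) 1) s

/-- The orbit of `P` under the (local) group of motions, which is generated by the flows. -/
def orbit (M : Set Pt) (G : Submodule ℝ (Pt → Pt)) (P : Pt) : Set Pt :=
  {Q | Relation.ReflTransGen (FlowsTo M G) P Q}

/-- Space-time homogeneity: the orbit of every point is the whole manifold. -/
def IsSTHomogeneous (M : Set Pt) (G : Submodule ℝ (Pt → Pt)) : Prop :=
  ∀ P ∈ M, orbit M G P = M

/-- The Gödel-type metric `ds² = (dt + H(x) dy)² - D(x)² dy² - dx² - dz²`. -/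
def godelMetric (H D : ℝ → ℝ) (p : Pt) : Matrix (Fin 4) (Fin 4) ℝ :=
  !![1, 0, H (p 1), 0;
     0, -1, 0, 0;
     H (p 1), 0, H (p 1) ^ 2 - D (p 1) ^ 2, 0;
     0, 0, 0, -1]

/-- The torsion whose only nonzero components are `T^t_{xy} = -T^t_{yx} = D(x) S(z)`. -/
def polarizedTorsion (D S : ℝ → ℝ) (p : Pt) (a b c : Fin 4) : ℝ :=
  if a = 0 ∧ b = 1 ∧ c = 2 then D (p 1) * S (p 3)
  else if a = 0 ∧ b = 2 ∧ c = 1 then -(D (p 1) * S (p 3))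
  else 0

/-- The Lie algebra of affine-isometric motions of the Riemann-Cartan Gödel-type space-time on
the coordinate domain `M`. -/
noncomputable def godelMotions (M : Set Pt) (H D S : ℝ → ℝ) : Submodule ℝ (Pt → Pt) :=
  motions M (godelMetric H D) (connection (godelMetric H D) (polarizedTorsion D S))

end RiemannCartan

open RiemannCartan

/-! Write $\xi=(\xi^t,\xi^x,\xi^y,\xi^z)$. The torsion is the antisymmetric part of $\Gamma$, so a
field preserving $\Gamma$ preserves the torsion too. Since $T^t{}_{xy}=DS$ is the only torsion
component, $\mathcal L_\xi T=0$ gives $\partial_t\xi^x=\partial_t\xi^y=0$ wherever $S\ne0$; combined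
with the Killing equations its $t$-component reduces to $\xi^z D S'=0$ (`static_of_S_ne_zero`). A
non-constant $S$ has a slice $z=z_0$ with $S\ne0$ and $S'\ne0$. The Killing equations carry the
conclusion off that slice: first $\xi^z=0$ on $M$, then $\partial_z\xi=0$, then $\partial_t\xi=0$.

What remains is $\xi^x=h(y)$, together with the gradients of $\xi^t$ and $\xi^y$ as explicit linear
expressions in $h,h'$. Equality of mixed partials is equivalent to $h''=(DD''-D'^2)h$ and
$h\,(DH''-D'H')=0$. This reduced system is `IsGodelField`; `isGodelField` shows that it is necessary
and `mem_godelMotions` that it is sufficient.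

If $h$ is nonzero somewhere, both brackets are controlled: $H'/D$ is constant and $DD''-D'^2$ is a
constant, which makes $D''/D$ constant. In the generic case therefore $h=0$ and only
$\partial_t,\partial_y$ survive. If both ratios are constant, then $DD''-D'^2=k$, the second
condition is void, and $h''=kh$ has a two-dimensional solution space, every member of which
integrates to a motion. With the two translations this gives dimension four. A motion is then
determined by $(\xi^t,\xi^x,\xi^y,\partial_y\xi^x)$ at a point, which yields isotropy and orbit
dimensions; $\xi^z=0$ confines orbits to $z$-slices. -/

namespace RiemannCartan

open Function

/-! ### Calculus of coordinate partial derivatives -/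

theorem pd_congr {f h : Pt → ℝ} {p : Pt} (i : Fin 4) (e : f =ᶠ[nhds p] h) :
    pd i f p = pd i h p :=
  congrArg (fun L : Pt →L[ℝ] ℝ => L (Pi.single i 1)) e.fderiv_eq

theorem pd_congr_on {M : Set Pt} (hM : IsOpen M) {f h : Pt → ℝ} {p : Pt} (hp : p ∈ M) (i : Fin 4)
    (e : ∀ q ∈ M, f q = h q) : pd i f p = pd i h p :=
  pd_congr i (Filter.eventuallyEq_of_mem (hM.mem_nhds hp) e)

@[simp] theorem pd_const (i : Fin 4) (c : ℝ) (p : Pt) : pd i (fun _ => c) p = 0 := by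
  simp [pd]

theorem pd_sub {f h : Pt → ℝ} {p : Pt} (i : Fin 4) (hf : DifferentiableAt ℝ f p)
    (hh : DifferentiableAt ℝ h p) : pd i (fun q => f q - h q) p = pd i f p - pd i h p := by
  unfold pd
  rw [fderiv_fun_sub hf hh]
  rfl

theorem pd_mul {f h : Pt → ℝ} {p : Pt} (i : Fin 4) (hf : DifferentiableAt ℝ f p)
    (hh : DifferentiableAt ℝ h p) :
    pd i (fun q => f q * h q) p = pd i f p * h p + f p * pd i h p := by
  unfold pd
  rw [fderiv_fun_mul hf hh]
  simp only [add_apply, FunLike.coe_smul, Pi.smul_apply, smul_eq_mul]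
  ring

theorem pd_coord {f : ℝ → ℝ} {p : Pt} (i j : Fin 4) (hf : DifferentiableAt ℝ f (p j)) :
    pd i (fun q => f (q j)) p = if i = j then deriv f (p j) else 0 := by
  have h1 : HasFDerivAt (fun q : Pt => q j) (ContinuousLinearMap.proj (R := ℝ) j) p :=
    (ContinuousLinearMap.proj (R := ℝ) (φ := fun _ : Fin 4 => ℝ) j).hasFDerivAt
  have h2 := hf.hasDerivAt.comp_hasFDerivAt p h1
  have h3 : pd i (fun q => f (q j)) p = deriv f (p j) * (Pi.single i 1 : Pt) j := by
    unfold pd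
    erw [h2.fderiv]
    simp
  rw [h3]
  by_cases h : i = j
  · subst h; simp
  · rw [if_neg h, Pi.single_eq_of_ne (Ne.symm h), mul_zero]

theorem differentiableAt_coord {f : ℝ → ℝ} {p : Pt} (j : Fin 4) (hf : DifferentiableAt ℝ f (p j)) :
    DifferentiableAt ℝ (fun q : Pt => f (q j)) p :=
  DifferentiableAt.comp (g := f) p hf (by fun_prop)

theorem pd_coord_mul_coord {u v : ℝ → ℝ} {p : Pt} {u' v' : ℝ} (i : Fin 4)
    (hu : HasDerivAt u u' (p 1)) (hv : HasDerivAt v v' (p 2)) :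
    pd i (fun q => u (q 1) * v (q 2)) p =
      if i = 1 then u' * v (p 2) else if i = 2 then u (p 1) * v' else 0 := by
  rw [pd_mul i (differentiableAt_coord 1 hu.differentiableAt)
      (differentiableAt_coord 2 hv.differentiableAt), pd_coord i 1 hu.differentiableAt, pd_coord i 2 hv.differentiableAt,
    hu.deriv, hv.deriv]
  fin_cases i <;> simp

theorem hasDerivAt_update {f : Pt → ℝ} {p : Pt} {i : Fin 4} {s : ℝ}
    (hf : DifferentiableAt ℝ f (update p i s)) :
    HasDerivAt (fun r => f (update p i r)) (pd i f (update p i s)) s :=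
  hf.hasFDerivAt.comp_hasDerivAt s (_root_.hasDerivAt_update p i s)

theorem pd_comm {f : Pt → ℝ} {p : Pt} (i j : Fin 4) (hf : ContDiffAt ℝ ∞ f p) :
    pd i (pd j f) p = pd j (pd i f) p := by
  have hs : IsSymmSndFDerivAt ℝ f p := hf.isSymmSndFDerivAt (by
    rw [minSmoothness_of_isRCLikeNormedField]; exact WithTop.coe_le_coe.2 (le_top : (2 : ℕ∞) ≤ ⊤))
  have hd : DifferentiableAt ℝ (fderiv ℝ f) p :=
    (hf.fderiv_right (m := ∞) (by simp)).differentiableAt (by simp)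
  have key : ∀ i j, pd i (pd j f) p = fderiv ℝ (fderiv ℝ f) p (Pi.single i 1) (Pi.single j 1) := by
    intro i j
    change fderiv ℝ (fun q => fderiv ℝ f q (Pi.single j 1)) p (Pi.single i 1) = _
    rw [fderiv_clm_apply hd (differentiableAt_const _)]
    simp
  rw [key, key, hs]

/-! ### Functions on a product of intervals -/

section Box

variable {I : Fin 4 → Set ℝ}

theorem isOpen_box (hopen : ∀ i, IsOpen (I i)) : IsOpen (Set.univ.pi I) :=
  isOpen_set_pi Set.finite_univ fun i _ => hopen i

theorem update_mem_box {p : Pt} (hp : p ∈ Set.univ.pi I) {i : Fin 4} {s : ℝ} (hs : s ∈ I i) :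
    update p i s ∈ Set.univ.pi I := by
  intro j _
  by_cases h : j = i
  · subst h; simpa using hs
  · simpa [h] using hp j trivial

theorem eq_of_deriv_eq_zero_on {J : Set ℝ} (hJ : J.OrdConnected) {f : ℝ → ℝ}
    (hf : ∀ s ∈ J, HasDerivAt f 0 s) {a b : ℝ} (ha : a ∈ J) (hb : b ∈ J) : f a = f b := by
  have := hJ.convex.norm_image_sub_le_of_norm_hasDerivWithin_le (C := 0)
    (fun s hs => (hf s hs).hasDerivWithinAt) (by simp) hb ha
  rwa [zero_mul, norm_le_zero_iff, sub_eq_zero] at this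

theorem update_eq_of_pd_eq_zero (hconn : ∀ i, (I i).OrdConnected) {f : Pt → ℝ} {p : Pt}
    {i : Fin 4} (hp : p ∈ Set.univ.pi I)
    (hf : ∀ s ∈ I i, DifferentiableAt ℝ f (update p i s))
    (h0 : ∀ s ∈ I i, pd i f (update p i s) = 0) {s : ℝ} (hs : s ∈ I i) :
    f (update p i s) = f p := by
  have := eq_of_deriv_eq_zero_on (hconn i) (f := fun r => f (update p i r))
    (fun r hr => by simpa [h0 r hr] using hasDerivAt_update (hf r hr)) hs (hp i trivial)
  simpa using this

theorem pd_eq_zero_of_update_eq (hopen : ∀ i, IsOpen (I i)) {f : Pt → ℝ} {p : Pt}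
    {i : Fin 4} (hp : p ∈ Set.univ.pi I) (hf : DifferentiableAt ℝ f p)
    (h0 : ∀ s ∈ I i, f (update p i s) = f p) : pd i f p = 0 := by
  have h1 : HasDerivAt (fun r => f (update p i r)) (pd i f p) (p i) := by
    simpa using hasDerivAt_update (p := p) (i := i) (s := p i) (f := f) (by simpa using hf)
  have h2 : (fun r => f (update p i r)) =ᶠ[nhds (p i)] fun _ => f p :=
    Filter.eventuallyEq_of_mem ((hopen i).mem_nhds (hp i trivial)) h0
  rw [← h1.deriv, h2.deriv_eq, deriv_const]

theorem eq_of_forall_pd_eq_zero (hconn : ∀ i, (I i).OrdConnected) {f : Pt → ℝ}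
    (hf : ∀ p ∈ Set.univ.pi I, DifferentiableAt ℝ f p)
    (h0 : ∀ p ∈ Set.univ.pi I, ∀ i, pd i f p = 0) {p q : Pt}
    (hp : p ∈ Set.univ.pi I) (hq : q ∈ Set.univ.pi I) : f p = f q := by
  have step : ∀ p ∈ Set.univ.pi I, ∀ i, ∀ s ∈ I i, f (update p i s) = f p := fun p hp i s hs =>
    update_eq_of_pd_eq_zero hconn hp (fun r hr => hf _ (update_mem_box hp hr))
      (fun r hr => h0 _ (update_mem_box hp hr) i) hs
  have hqi := fun i => hq i trivial
  -- Coordinates are changed one at a time; a product of intervals contains all the intermediate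
  -- points.
  have e : q = update (update (update (update p 0 (q 0)) 1 (q 1)) 2 (q 2)) 3 (q 3) := by
    ext i; fin_cases i <;> simp [update]
  rw [e, step _ (update_mem_box (update_mem_box (update_mem_box hp (hqi 0)) (hqi 1)) (hqi 2)) _ _
    (hqi 3), step _ (update_mem_box (update_mem_box hp (hqi 0)) (hqi 1)) _ _ (hqi 2),
    step _ (update_mem_box hp (hqi 0)) _ _ (hqi 1), step _ hp _ _ (hqi 0)]

end Box

/-! ### Inverse metric and connection coefficients -/

theorem forall_fin_four {P : Fin 4 → Prop} : (∀ i, P i) ↔ P 0 ∧ P 1 ∧ P 2 ∧ P 3 := by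
  rw [Fin.forall_fin_succ, Fin.forall_fin_succ, Fin.forall_fin_succ, Fin.forall_fin_one]
  rfl

theorem godelMetric_inv {H D : ℝ → ℝ} {p : Pt} (hD : D (p 1) ≠ 0) :
    (godelMetric H D p)⁻¹ =
      !![1 - H (p 1) ^ 2 / D (p 1) ^ 2, 0, H (p 1) / D (p 1) ^ 2, 0;
         0, -1, 0, 0;
         H (p 1) / D (p 1) ^ 2, 0, -1 / D (p 1) ^ 2, 0;
         0, 0, 0, -1] := by
  refine Matrix.inv_eq_right_inv ?_
  ext i j
  revert i j
  simp only [forall_fin_four, godelMetric, Matrix.mul_apply, Fin.sum_univ_four, Matrix.of_apply,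
    Matrix.cons_val', Matrix.cons_val, Matrix.one_apply, Fin.reduceEq, zero_ne_one, one_ne_zero,
    if_true, if_false]
  constructorm* _ ∧ _ <;> field_simp <;> ring

/-- The values of the only nonvanishing partial derivatives `∂ₓ g_{ab}` of the Gödel-type metric. -/
noncomputable def godelMetricDeriv (H D : ℝ → ℝ) (p : Pt) : Matrix (Fin 4) (Fin 4) ℝ :=
  !![0, 0, deriv H (p 1), 0;
     0, 0, 0, 0;
     deriv H (p 1), 0, 2 * (H (p 1) * deriv H (p 1) - D (p 1) * deriv D (p 1)), 0;
     0, 0, 0, 0]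

theorem pd_godelMetric {H D : ℝ → ℝ} {p : Pt} (hH : DifferentiableAt ℝ H (p 1))
    (hD : DifferentiableAt ℝ D (p 1)) (d a b : Fin 4) :
    pd d (fun q => godelMetric H D q a b) p =
      if d = 1 then godelMetricDeriv H D p a b else 0 := by
  have h22 : pd d (fun q => H (q 1) ^ 2 - D (q 1) ^ 2) p =
      if d = 1 then 2 * (H (p 1) * deriv H (p 1) - D (p 1) * deriv D (p 1)) else 0 := by
    have e : HasDerivAt (fun x => H x ^ 2 - D x ^ 2)
        (2 * (H (p 1) * deriv H (p 1) - D (p 1) * deriv D (p 1))) (p 1) := by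
      exact ((hH.hasDerivAt.pow 2).sub (hD.hasDerivAt.pow 2)).congr_deriv (by norm_num; ring)
    rw [pd_coord (f := fun x => H x ^ 2 - D x ^ 2) d 1 e.differentiableAt, e.deriv]
  have h02 := pd_coord d 1 hH
  fin_cases a <;> fin_cases b <;>
    simp only [godelMetric, godelMetricDeriv, Matrix.of_apply, Matrix.cons_val', Matrix.cons_val,
      Fin.zero_eta, Fin.mk_one, Fin.reduceFinMk, pd_const, ite_self, h02, h22]

/-- The coefficients `Γ^a_{bc}` as rational functions of `H`, `D`, `H'`, `D'`, `S`. -/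
noncomputable def godelGamma (H D H' D' s : ℝ) : Fin 4 → Matrix (Fin 4) (Fin 4) ℝ :=
  ![!![0, (H' - D * s) / 2 * H / D ^ 2, 0, 0;
       (H' - D * s) / 2 * H / D ^ 2, 0,
          (H' + D * s) / 2 * (1 - H ^ 2 / D ^ 2) + H * (H * H' - D * D') / D ^ 2, 0;
       0, (H' - D * s) / 2 * (1 - H ^ 2 / D ^ 2) + H * (H * H' - D * D' - H * (D * s)) / D ^ 2,
          0, 0;
       0, 0, 0, 0],
    !![0, 0, (H' - D * s) / 2, 0;
       0, 0, 0, 0;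
       (H' - D * s) / 2, 0, H * H' - D * D' - H * (D * s), 0;
       0, 0, 0, 0],
    !![0, -((H' - D * s) / 2 / D ^ 2), 0, 0;
       -((H' - D * s) / 2 / D ^ 2), 0, (H' + D * s) / 2 * H / D ^ 2 - (H * H' - D * D') / D ^ 2, 0;
       0, (H' - D * s) / 2 * H / D ^ 2 - (H * H' - D * D' - H * (D * s)) / D ^ 2, 0, 0;
       0, 0, 0, 0],
    0]

theorem connection_godel {H D S : ℝ → ℝ} {p : Pt} (hH : DifferentiableAt ℝ H (p 1))
    (hD : DifferentiableAt ℝ D (p 1)) (hD0 : D (p 1) ≠ 0) (a b c : Fin 4) :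
    connection (godelMetric H D) (polarizedTorsion D S) p a b c =
      godelGamma (H (p 1)) (D (p 1)) (deriv H (p 1)) (deriv D (p 1)) (S (p 3)) a b c := by
  unfold connection christoffel contorsion lowerTorsion
  simp only [godelMetric_inv hD0, pd_godelMetric hH hD, Fin.sum_univ_four]
  revert a b c
  simp only [forall_fin_four]
  simp only [godelMetric, godelMetricDeriv, godelGamma, polarizedTorsion, Matrix.of_apply,
    Matrix.cons_val', Matrix.cons_val, zero_ne_one, Fin.reduceEq, if_true, if_false, true_and,
    and_false, and_true, mul_zero, zero_mul, mul_neg, neg_zero, one_ne_zero, Matrix.zero_apply,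
    add_zero, zero_add, sub_zero, zero_sub, sub_self, one_mul, neg_mul, neg_neg]
  constructorm* _ ∧ _ <;> first | trivial | (field_simp; ring)

/-- The `x`-derivatives of the coefficients `godelGamma`. -/
noncomputable def godelGammaDeriv (H D H' D' H'' D'' s : ℝ) : Fin 4 → Matrix (Fin 4) (Fin 4) ℝ :=
  ![!![0, (((H'' - D' * s) / 2) * H + ((H' - D * s) / 2) * H') / D ^ 2 - ((H' - D * s) / 2) * H * (2 * D') / D ^ 3, 0, 0;
       (((H'' - D' * s) / 2) * H + ((H' - D * s) / 2) * H') / D ^ 2 - ((H' - D * s) / 2) * H * (2 * D') / D ^ 3, 0,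
          ((H'' + D' * s) / 2) * (1 - H ^ 2 / D ^ 2) - ((H' + D * s) / 2) * (2 * H * H' / D ^ 2 - H ^ 2 * (2 * D') / D ^ 3) +
            ((H' * (H * H' - D * D') + H * (H' ^ 2 + H * H'' - D' ^ 2 - D * D'')) / D ^ 2 - H * (H * H' - D * D') * (2 * D') / D ^ 3), 0;
       0, ((H'' - D' * s) / 2) * (1 - H ^ 2 / D ^ 2) - ((H' - D * s) / 2) * (2 * H * H' / D ^ 2 - H ^ 2 * (2 * D') / D ^ 3) +
            ((H' * (H * H' - D * D' - H * (D * s)) + H * (H' ^ 2 + H * H'' - D' ^ 2 - D * D'' - (H' * D + H * D') * s)) / D ^ 2 - H * (H * H' - D * D' - H * (D * s)) * (2 * D') / D ^ 3),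
          0, 0;
       0, 0, 0, 0],
    !![0, 0, ((H'' - D' * s) / 2), 0;
       0, 0, 0, 0;
       ((H'' - D' * s) / 2), 0,
          (H' ^ 2 + H * H'' - D' ^ 2 - D * D'' - (H' * D + H * D') * s), 0;
       0, 0, 0, 0],
    !![0, -(((H'' - D' * s) / 2) / D ^ 2 - ((H' - D * s) / 2) * (2 * D') / D ^ 3), 0, 0;
       -(((H'' - D' * s) / 2) / D ^ 2 - ((H' - D * s) / 2) * (2 * D') / D ^ 3), 0,
          (((H'' + D' * s) / 2) * H + ((H' + D * s) / 2) * H' - (H' ^ 2 + H * H'' - D' ^ 2 - D * D'')) / D ^ 2 - (((H' + D * s) / 2) * H - (H * H' - D * D')) * (2 * D') / D ^ 3, 0;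
       0, (((H'' - D' * s) / 2) * H + ((H' - D * s) / 2) * H' - (H' ^ 2 + H * H'' - D' ^ 2 - D * D'' - (H' * D + H * D') * s)) / D ^ 2 - (((H' - D * s) / 2) * H - (H * H' - D * D' - H * (D * s))) * (2 * D') / D ^ 3,
          0, 0;
       0, 0, 0, 0],
    0]

theorem hasDerivAt_godelGamma {H D H' D' : ℝ → ℝ} {H'' D'' x : ℝ} (s : ℝ)
    (hH : HasDerivAt H (H' x) x) (hD : HasDerivAt D (D' x) x) (hH' : HasDerivAt H' H'' x)
    (hD' : HasDerivAt D' D'' x) (hD0 : D x ≠ 0) (a b c : Fin 4) :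
    HasDerivAt (fun r => godelGamma (H r) (D r) (H' r) (D' r) s a b c)
      (godelGammaDeriv (H x) (D x) (H' x) (D' x) H'' D'' s a b c) x := by
  have hα : HasDerivAt (fun r => (H' r - D r * s) / 2) ((H'' - D' x * s) / 2) x :=
    (hH'.sub (hD.mul_const s)).div_const 2
  have hβ : HasDerivAt (fun r => (H' r + D r * s) / 2) ((H'' + D' x * s) / 2) x :=
    (hH'.add (hD.mul_const s)).div_const 2
  have hφ : HasDerivAt (fun r => H r * H' r - D r * D' r)
      (H' x ^ 2 + H x * H'' - D' x ^ 2 - D x * D'') x :=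
    ((hH.mul hH').sub (hD.mul hD')).congr_deriv (by ring)
  have hψ : HasDerivAt (fun r => H r * H' r - D r * D' r - H r * (D r * s))
      (H' x ^ 2 + H x * H'' - D' x ^ 2 - D x * D'' - (H' x * D x + H x * D' x) * s) x :=
    (hφ.sub (hH.mul (hD.mul_const s))).congr_deriv (by ring)
  have hj : HasDerivAt (fun r => 1 - H r ^ 2 / D r ^ 2)
      (-(2 * H x * H' x / D x ^ 2 - H x ^ 2 * (2 * D' x) / D x ^ 3)) x :=
    (((hH.pow 2).div (hD.pow 2) (pow_ne_zero 2 hD0)).const_sub 1).congr_deriv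
      (by norm_num; field_simp; ring)
  revert a b c
  simp only [forall_fin_four, godelGamma, godelGammaDeriv, Matrix.of_apply, Matrix.cons_val',
    Matrix.cons_val, Matrix.zero_apply]
  have hD2 := hD.pow 2
  have hD20 := pow_ne_zero 2 hD0
  have e01 := (hα.mul hH).div hD2 hD20
  have e12 := (hβ.mul hj).add ((hH.mul hφ).div hD2 hD20)
  have e21 := (hα.mul hj).add ((hH.mul hψ).div hD2 hD20)
  have m01 := (hα.div hD2 hD20).neg
  have r12 := ((hβ.mul hH).div hD2 hD20).sub (hφ.div hD2 hD20)
  have r21 := ((hα.mul hH).div hD2 hD20).sub (hψ.div hD2 hD20)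
  refine ⟨⟨⟨?_, e01.congr_deriv ?_, ?_, ?_⟩, ⟨e01.congr_deriv ?_, ?_, e12.congr_deriv ?_, ?_⟩,
      ⟨?_, e21.congr_deriv ?_, ?_, ?_⟩, ?_, ?_, ?_, ?_⟩,
    ⟨⟨?_, ?_, hα, ?_⟩, ⟨?_, ?_, ?_, ?_⟩, ⟨hα, ?_, hψ, ?_⟩, ?_, ?_, ?_, ?_⟩,
    ⟨⟨?_, m01.congr_deriv ?_, ?_, ?_⟩, ⟨m01.congr_deriv ?_, ?_, r12.congr_deriv ?_, ?_⟩,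
      ⟨?_, r21.congr_deriv ?_, ?_, ?_⟩, ?_, ?_, ?_, ?_⟩,
    ⟨?_, ?_, ?_, ?_⟩, ⟨?_, ?_, ?_, ?_⟩, ⟨?_, ?_, ?_, ?_⟩, ?_, ?_, ?_, ?_⟩
  all_goals first
    | exact hasDerivAt_const _ _
    | (simp only [Nat.cast_ofNat, Nat.reduceSub, pow_one, Pi.pow_apply, Pi.mul_apply]
       field_simp <;> ring)

/-! ### Smooth backgrounds and derivatives of their coefficients -/

/-- The standing hypotheses on the coordinate box and on the functions `H`, `D`, `S`. -/
structure IsGodelBackground (I : Fin 4 → Set ℝ) (H D S : ℝ → ℝ) : Prop where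
  isOpen : ∀ i, IsOpen (I i)
  ordConnected : ∀ i, (I i).OrdConnected
  contDiffOn_H : ContDiffOn ℝ ∞ H (I 1)
  contDiffOn_D : ContDiffOn ℝ ∞ D (I 1)
  contDiffOn_S : ContDiffOn ℝ ∞ S (I 3)
  D_ne_zero : ∀ x ∈ I 1, D x ≠ 0

theorem hasDerivAt_of_contDiffOn {f : ℝ → ℝ} {J : Set ℝ} (hJ : IsOpen J)
    (hf : ContDiffOn ℝ ∞ f J) {x : ℝ} (hx : x ∈ J) : HasDerivAt f (deriv f x) x :=
  ((hf.contDiffAt (hJ.mem_nhds hx)).differentiableAt (by simp)).hasDerivAt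

theorem contDiffOn_deriv {f : ℝ → ℝ} {J : Set ℝ} (hJ : IsOpen J) (hf : ContDiffOn ℝ ∞ f J) :
    ContDiffOn ℝ ∞ (deriv f) J :=
  ((contDiffOn_infty_iff_deriv_of_isOpen hJ).1 hf).2

theorem differentiableAt_godelGamma_comp {H D H' D' s : Pt → ℝ} {p : Pt}
    (hH : DifferentiableAt ℝ H p) (hD : DifferentiableAt ℝ D p) (hH' : DifferentiableAt ℝ H' p)
    (hD' : DifferentiableAt ℝ D' p) (hs : DifferentiableAt ℝ s p) (hD0 : D p ≠ 0)
    (a b c : Fin 4) :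
    DifferentiableAt ℝ (fun q => godelGamma (H q) (D q) (H' q) (D' q) (s q) a b c) p := by
  have h0 : D p ^ 2 ≠ 0 := pow_ne_zero 2 hD0
  revert a b c
  simp only [forall_fin_four, godelGamma, Matrix.of_apply, Matrix.cons_val',
    Matrix.cons_val, Matrix.zero_apply]
  constructorm* _ ∧ _ <;> fun_prop (disch := exact h0)

namespace IsGodelBackground

variable {I : Fin 4 → Set ℝ} {H D S : ℝ → ℝ}

theorem hasDerivAt_H (B : IsGodelBackground I H D S) {x : ℝ} (hx : x ∈ I 1) :
    HasDerivAt H (deriv H x) x :=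
  hasDerivAt_of_contDiffOn (B.isOpen 1) B.contDiffOn_H hx

theorem hasDerivAt_D (B : IsGodelBackground I H D S) {x : ℝ} (hx : x ∈ I 1) :
    HasDerivAt D (deriv D x) x :=
  hasDerivAt_of_contDiffOn (B.isOpen 1) B.contDiffOn_D hx

theorem hasDerivAt_S (B : IsGodelBackground I H D S) {z : ℝ} (hz : z ∈ I 3) :
    HasDerivAt S (deriv S z) z :=
  hasDerivAt_of_contDiffOn (B.isOpen 3) B.contDiffOn_S hz

theorem hasDerivAt_deriv_H (B : IsGodelBackground I H D S) {x : ℝ} (hx : x ∈ I 1) :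
    HasDerivAt (deriv H) (deriv (deriv H) x) x :=
  hasDerivAt_of_contDiffOn (B.isOpen 1) (contDiffOn_deriv (B.isOpen 1) B.contDiffOn_H) hx

theorem hasDerivAt_deriv_D (B : IsGodelBackground I H D S) {x : ℝ} (hx : x ∈ I 1) :
    HasDerivAt (deriv D) (deriv (deriv D) x) x :=
  hasDerivAt_of_contDiffOn (B.isOpen 1) (contDiffOn_deriv (B.isOpen 1) B.contDiffOn_D) hx

/-- The functions differentiated here and in the next three lemmas are the coefficients of $h'$ and
$h$ in the gradients of $\xi^t$ and $\xi^y$; their derivatives enter the mixed partials. -/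
theorem hasDerivAt_H_div_sq (B : IsGodelBackground I H D S) {x : ℝ} (hx : x ∈ I 1) :
    HasDerivAt (fun r => H r / D r ^ 2)
      (deriv H x / D x ^ 2 - 2 * H x * deriv D x / D x ^ 3) x := by
  have hD0 := B.D_ne_zero x hx
  refine ((B.hasDerivAt_H hx).div ((B.hasDerivAt_D hx).pow 2) (pow_ne_zero 2 hD0)).congr_deriv ?_
  simp only [Nat.cast_ofNat, Nat.reduceSub, pow_one, Pi.pow_apply]
  field_simp

theorem hasDerivAt_neg_inv_sq (B : IsGodelBackground I H D S) {x : ℝ} (hx : x ∈ I 1) :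
    HasDerivAt (fun r => -1 / D r ^ 2) (2 * deriv D x / D x ^ 3) x := by
  have hD0 := B.D_ne_zero x hx
  refine ((hasDerivAt_const x (-1 : ℝ)).div ((B.hasDerivAt_D hx).pow 2)
    (pow_ne_zero 2 hD0)).congr_deriv ?_
  simp only [Nat.cast_ofNat, Nat.reduceSub, pow_one, Pi.pow_apply]
  field_simp
  ring

theorem hasDerivAt_neg_logDeriv (B : IsGodelBackground I H D S) {x : ℝ} (hx : x ∈ I 1) :
    HasDerivAt (fun r => -(deriv D r / D r))
      (-((D x * deriv (deriv D) x - deriv D x ^ 2) / D x ^ 2)) x :=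
  ((B.hasDerivAt_deriv_D hx).div (B.hasDerivAt_D hx) (B.D_ne_zero x hx)).neg.congr_deriv
    (by ring)

theorem hasDerivAt_shear (B : IsGodelBackground I H D S) {x : ℝ} (hx : x ∈ I 1) :
    HasDerivAt (fun r => -deriv H r + H r * (deriv D r / D r))
      (-deriv (deriv H) x + (deriv H x * (deriv D x / D x) +
        H x * ((D x * deriv (deriv D) x - deriv D x ^ 2) / D x ^ 2))) x :=
  ((B.hasDerivAt_deriv_H hx).neg.add ((B.hasDerivAt_H hx).mul
    ((B.hasDerivAt_deriv_D hx).div (B.hasDerivAt_D hx) (B.D_ne_zero x hx)))).congr_deriv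
    (by simp only [Pi.div_apply]; ring)

theorem connection_eq (B : IsGodelBackground I H D S) {p : Pt} (hp : p ∈ Set.univ.pi I)
    (a b c : Fin 4) : connection (godelMetric H D) (polarizedTorsion D S) p a b c =
      godelGamma (H (p 1)) (D (p 1)) (deriv H (p 1)) (deriv D (p 1)) (S (p 3)) a b c :=
  connection_godel (B.hasDerivAt_H (hp 1 trivial)).differentiableAt
    (B.hasDerivAt_D (hp 1 trivial)).differentiableAt (B.D_ne_zero _ (hp 1 trivial)) a b c

theorem differentiableAt_godelGamma (B : IsGodelBackground I H D S) {p : Pt}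
    (hp : p ∈ Set.univ.pi I) (a b c : Fin 4) :
    DifferentiableAt ℝ (fun q : Pt =>
      godelGamma (H (q 1)) (D (q 1)) (deriv H (q 1)) (deriv D (q 1)) (S (q 3)) a b c) p := by
  have hx := hp 1 trivial
  have e1 := differentiableAt_coord 1 (B.hasDerivAt_H hx).differentiableAt
  have e2 := differentiableAt_coord 1 (B.hasDerivAt_D hx).differentiableAt
  have e3 := differentiableAt_coord 1 (B.hasDerivAt_deriv_H hx).differentiableAt
  have e4 := differentiableAt_coord 1 (B.hasDerivAt_deriv_D hx).differentiableAt
  have e5 := differentiableAt_coord 3 (B.hasDerivAt_S (hp 3 trivial)).differentiableAt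
  exact differentiableAt_godelGamma_comp e1 e2 e3 e4 e5 (B.D_ne_zero _ hx) a b c

theorem differentiableAt_connection (B : IsGodelBackground I H D S) {p : Pt}
    (hp : p ∈ Set.univ.pi I) (a b c : Fin 4) :
    DifferentiableAt ℝ (fun q : Pt =>
      connection (godelMetric H D) (polarizedTorsion D S) q a b c) p :=
  (B.differentiableAt_godelGamma hp a b c).congr_of_eventuallyEq
    (Filter.eventuallyEq_of_mem ((isOpen_box B.isOpen).mem_nhds hp)
      fun _ hq => B.connection_eq hq a b c)

/-- The direction $d=3$, where $S'$ would appear, is excluded: in the Lie derivative it is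
multiplied by $\xi^z$, which is zero for the fields in question. -/
theorem pd_connection (B : IsGodelBackground I H D S) {p : Pt} (hp : p ∈ Set.univ.pi I)
    {d : Fin 4} (hd : d ≠ 3) (a b c : Fin 4) :
    pd d (fun q => connection (godelMetric H D) (polarizedTorsion D S) q a b c) p =
      if d = 1 then godelGammaDeriv (H (p 1)) (D (p 1)) (deriv H (p 1)) (deriv D (p 1))
        (deriv (deriv H) (p 1)) (deriv (deriv D) (p 1)) (S (p 3)) a b c else 0 := by
  rw [pd_congr_on (isOpen_box B.isOpen) hp d fun q hq => B.connection_eq hq a b c]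
  have h1 := hasDerivAt_update (p := p) (i := d) (s := p d)
    (by simpa only [update_eq_self] using B.differentiableAt_godelGamma hp a b c)
  rw [update_eq_self] at h1
  by_cases h : d = 1
  · subst h
    have h2 := hasDerivAt_godelGamma (S (p 3)) (B.hasDerivAt_H (hp 1 trivial))
      (B.hasDerivAt_D (hp 1 trivial)) (B.hasDerivAt_deriv_H (hp 1 trivial))
      (B.hasDerivAt_deriv_D (hp 1 trivial)) (B.D_ne_zero _ (hp 1 trivial)) a b c
    simp only [update_self, update_of_ne (show (3 : Fin 4) ≠ 1 by decide)] at h1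
    rw [if_pos rfl, h1.unique h2]
  · simp only [update_of_ne (Ne.symm h), update_of_ne (Ne.symm hd)] at h1
    rw [if_neg h, h1.unique (hasDerivAt_const _ _)]

end IsGodelBackground

/-! ### The reduced system and its sufficiency -/

/-- The fields solving the reduced system for affine-isometric motions: `ξ^z = 0`, `ξ^x = h(y)`, and
the remaining components are determined up to constants by `h`. -/
structure IsGodelField (I : Fin 4 → Set ℝ) (H D h : ℝ → ℝ) (ξ : Pt → Pt) : Prop where
  zero_off : ∀ p ∉ Set.univ.pi I, ξ p = 0
  smooth : ∀ p ∈ Set.univ.pi I, ContDiffAt ℝ ∞ ξ p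
  smooth_profile : ContDiffOn ℝ ∞ h (I 2)
  apply_three : ∀ p ∈ Set.univ.pi I, ξ p 3 = 0
  apply_one : ∀ p ∈ Set.univ.pi I, ξ p 1 = h (p 2)
  pd_two : ∀ p ∈ Set.univ.pi I, ∀ i, pd i (fun q => ξ q 2) p =
    if i = 1 then -1 / D (p 1) ^ 2 * deriv h (p 2)
    else if i = 2 then -(deriv D (p 1) / D (p 1)) * h (p 2) else 0
  pd_zero : ∀ p ∈ Set.univ.pi I, ∀ i, pd i (fun q => ξ q 0) p =
    if i = 1 then H (p 1) / D (p 1) ^ 2 * deriv h (p 2)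
    else if i = 2 then (-deriv H (p 1) + H (p 1) * (deriv D (p 1) / D (p 1))) * h (p 2) else 0
  profile_ode : ∀ x ∈ I 1, ∀ y ∈ I 2,
    deriv (deriv h) y = h y * (D x * deriv (deriv D) x - deriv D x ^ 2)
  profile_mul : ∀ x ∈ I 1, ∀ y ∈ I 2,
    h y * (D x * deriv (deriv H) x - deriv D x * deriv H x) = 0

/-- Applied to $f=\xi^t$ and $f=\xi^y$, both of whose gradients have this separated form. It serves
both the check of $\mathcal L_\xi\Gamma=0$ and the comparison of mixed partials. -/
theorem pd_pd_of_pd_eq {I : Fin 4 → Set ℝ} {H D S h : ℝ → ℝ} (B : IsGodelBackground I H D S) (hh : ContDiffOn ℝ ∞ h (I 2))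
    {p : Pt} (hp : p ∈ Set.univ.pi I) {f : Pt → ℝ} {u v : ℝ → ℝ} {u' v' : ℝ}
    (hf : ∀ q ∈ Set.univ.pi I, ∀ i, pd i f q =
      if i = 1 then u (q 1) * deriv h (q 2) else if i = 2 then v (q 1) * h (q 2) else 0)
    (hu : HasDerivAt u u' (p 1)) (hv : HasDerivAt v v' (p 1)) (b c : Fin 4) :
    pd b (pd c f) p =
      if c = 1 then
        if b = 1 then u' * deriv h (p 2) else if b = 2 then u (p 1) * deriv (deriv h) (p 2) else 0
      else if c = 2 then
        if b = 1 then v' * h (p 2) else if b = 2 then v (p 1) * deriv h (p 2) else 0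
      else 0 := by
  rw [pd_congr_on (isOpen_box B.isOpen) hp b fun q hq => hf q hq c]
  by_cases h1 : c = 1
  · simp only [h1, if_true]
    exact pd_coord_mul_coord b hu (hasDerivAt_of_contDiffOn (B.isOpen 2)
      (contDiffOn_deriv (B.isOpen 2) hh) (hp 2 trivial))
  · by_cases h2 : c = 2
    · simp only [h2, if_true, Fin.reduceEq, if_false]
      exact pd_coord_mul_coord b hv
        (hasDerivAt_of_contDiffOn (B.isOpen 2) hh (hp 2 trivial))
    · simp [h1, h2]

namespace IsGodelField

variable {I : Fin 4 → Set ℝ} {H D S h : ℝ → ℝ} {ξ : Pt → Pt}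

theorem pd_one (B : IsGodelBackground I H D S) (F : IsGodelField I H D h ξ) {p : Pt}
    (hp : p ∈ Set.univ.pi I) (i : Fin 4) :
    pd i (fun q => ξ q 1) p = if i = 2 then deriv h (p 2) else 0 := by
  rw [pd_congr_on (isOpen_box B.isOpen) hp i F.apply_one, pd_coord i 2
    (hasDerivAt_of_contDiffOn (B.isOpen 2) F.smooth_profile (hp 2 trivial)).differentiableAt]

theorem pd_three (B : IsGodelBackground I H D S) (F : IsGodelField I H D h ξ) {p : Pt}
    (hp : p ∈ Set.univ.pi I) (i : Fin 4) : pd i (fun q => ξ q 3) p = 0 := by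
  rw [pd_congr_on (isOpen_box B.isOpen) hp i F.apply_three, pd_const]

theorem lieMetric_eq_zero (B : IsGodelBackground I H D S) (F : IsGodelField I H D h ξ) {p : Pt}
    (hp : p ∈ Set.univ.pi I) (a b : Fin 4) : lieMetric (godelMetric H D) ξ p a b = 0 := by
  have hD0 := B.D_ne_zero _ (hp 1 trivial)
  have hg := fun d a b => pd_godelMetric (B.hasDerivAt_H (hp 1 trivial)).differentiableAt
    (B.hasDerivAt_D (hp 1 trivial)).differentiableAt d a b
  revert a b
  simp only [lieMetric, hg, Fin.sum_univ_four, F.pd_zero p hp, F.pd_one B hp, F.pd_two p hp,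
    F.pd_three B hp, F.apply_one p hp, F.apply_three p hp]
  simp only [forall_fin_four, godelMetric, godelMetricDeriv, Matrix.of_apply, Matrix.cons_val',
    Matrix.cons_val, zero_ne_one, Fin.reduceEq, if_true, if_false, mul_zero, zero_mul, add_zero,
    zero_add]
  constructorm* _ ∧ _ <;> first | trivial | (field_simp; ring1)

variable {p : Pt}

theorem pd_pd_one (B : IsGodelBackground I H D S) (F : IsGodelField I H D h ξ)
    (hp : p ∈ Set.univ.pi I) (b c : Fin 4) :
    pd b (pd c (fun q => ξ q 1)) p =
      if b = 2 then if c = 2 then deriv (deriv h) (p 2) else 0 else 0 := by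
  rw [pd_congr_on (isOpen_box B.isOpen) hp b fun q hq => F.pd_one B hq c]
  by_cases hc : c = 2
  · simp only [hc, if_true]
    exact pd_coord b 2 (hasDerivAt_of_contDiffOn (B.isOpen 2)
      (contDiffOn_deriv (B.isOpen 2) F.smooth_profile) (hp 2 trivial)).differentiableAt
  · simp [hc]

theorem pd_pd_three (B : IsGodelBackground I H D S) (F : IsGodelField I H D h ξ)
    (hp : p ∈ Set.univ.pi I) (b c : Fin 4) : pd b (pd c (fun q => ξ q 3)) p = 0 := by
  rw [pd_congr_on (isOpen_box B.isOpen) hp b fun q hq => F.pd_three B hq c, pd_const]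

/-- Once the reduced system expresses all first and second derivatives of $\xi$ through $h$ and
$h'$, each component is a rational identity in the values of $H,D,S$ and their derivatives at the
point. -/
theorem lieConnection_eq_zero (B : IsGodelBackground I H D S) (F : IsGodelField I H D h ξ)
    (hp : p ∈ Set.univ.pi I) (a b c : Fin 4) :
    lieConnection (connection (godelMetric H D) (polarizedTorsion D S)) ξ p a b c = 0 := by
  have hx := hp 1 trivial
  have hD0 := B.D_ne_zero _ hx
  have e0 := pd_pd_of_pd_eq B F.smooth_profile hp F.pd_zero (B.hasDerivAt_H_div_sq hx) (B.hasDerivAt_shear hx)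
  have e2 := pd_pd_of_pd_eq B F.smooth_profile hp F.pd_two (B.hasDerivAt_neg_inv_sq hx)
    (B.hasDerivAt_neg_logDeriv hx)
  have hode := F.profile_ode _ hx _ (hp 2 trivial)
  have hmul := F.profile_mul _ hx _ (hp 2 trivial)
  have h3 := F.apply_three p hp
  revert a b c
  simp only [lieConnection, B.connection_eq hp, Fin.sum_univ_four, F.pd_zero p hp, F.pd_one B hp,
    F.pd_two p hp, F.pd_three B hp, F.apply_one p hp, h3, zero_mul,
    B.pd_connection hp (show (0 : Fin 4) ≠ 3 by decide),
    B.pd_connection hp (show (1 : Fin 4) ≠ 3 by decide),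
    B.pd_connection hp (show (2 : Fin 4) ≠ 3 by decide)]
  simp only [forall_fin_four, F.pd_zero p hp, F.pd_one B hp, F.pd_two p hp, F.pd_three B hp, e0,
    F.pd_pd_one B hp, e2, F.pd_pd_three B hp, hode]
  generalize h (p 2) = X at *
  generalize deriv h (p 2) = X' at *
  generalize D (p 1) = D0 at *
  generalize deriv D (p 1) = D1 at *
  generalize deriv (deriv D) (p 1) = D2 at *
  generalize H (p 1) = H0 at *
  generalize deriv H (p 1) = H1 at *
  generalize deriv (deriv H) (p 1) = H2 at *
  generalize S (p 3) = s at *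
  clear * - hD0 hmul
  simp only [godelGamma, godelGammaDeriv, Matrix.of_apply, Matrix.cons_val',
    Matrix.cons_val, zero_ne_one, Fin.reduceEq, if_true, if_false, mul_zero, zero_mul,
    add_zero, zero_add, sub_zero, zero_sub, sub_self, Matrix.zero_apply]
  -- Either $h$ vanishes at this value of $y$, or $H''$ is determined by $H'$, $D$ and $D'$. The
  -- value of $h'$ stays free in both cases.
  rcases mul_eq_zero.1 hmul with rfl | hH2
  · simp only [zero_mul, mul_zero, add_zero, zero_add]
    constructorm* _ ∧ _ <;> first | trivial | (field_simp; ring1)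
  · obtain rfl : H2 = D1 * H1 / D0 := by field_simp; linarith
    constructorm* _ ∧ _ <;> first | trivial | (field_simp; ring1)

theorem mem_godelMotions (B : IsGodelBackground I H D S) (F : IsGodelField I H D h ξ) :
    ξ ∈ godelMotions (Set.univ.pi I) H D S :=
  ⟨F.zero_off, F.smooth, fun _ hp => F.lieMetric_eq_zero B hp,
    fun _ hp => F.lieConnection_eq_zero B hp⟩

end IsGodelField

/-! ### Necessary conditions from the metric and the torsion -/

section

variable {I : Fin 4 → Set ℝ} {H D S : ℝ → ℝ} {ξ : Pt → Pt} {p : Pt}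

namespace IsGodelBackground

theorem connection_sub_swap (B : IsGodelBackground I H D S) (hp : p ∈ Set.univ.pi I)
    (a b c : Fin 4) :
    polarizedTorsion D S p a b c = connection (godelMetric H D) (polarizedTorsion D S) p a b c -
      connection (godelMetric H D) (polarizedTorsion D S) p a c b := by
  have hD0 := B.D_ne_zero _ (hp 1 trivial)
  simp only [B.connection_eq hp]
  revert a b c
  simp only [forall_fin_four, godelGamma, polarizedTorsion, Matrix.of_apply, Matrix.cons_val',
    Matrix.cons_val, Matrix.zero_apply, zero_ne_one, one_ne_zero, Fin.reduceEq, if_true, if_false,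
    true_and, and_false, and_true, sub_self]
  constructorm* _ ∧ _ <;> first | trivial | (field_simp; ring1)

/-- Antisymmetrizing $\mathcal L_\xi\Gamma=0$ in $b,c$ cancels the second derivatives of $\xi$,
because they commute, and leaves $\mathcal L_\xi T=0$. -/
theorem lieTorsion_eq_zero (B : IsGodelBackground I H D S)
    (hξ : ξ ∈ godelMotions (Set.univ.pi I) H D S) (hp : p ∈ Set.univ.pi I) (a b c : Fin 4) :
    ∑ d, (ξ p d * pd d (fun q => polarizedTorsion D S q a b c) p
      - polarizedTorsion D S p d b c * pd d (fun q => ξ q a) p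
      + polarizedTorsion D S p a d c * pd b (fun q => ξ q d) p
      + polarizedTorsion D S p a b d * pd c (fun q => ξ q d) p) = 0 := by
  obtain ⟨-, h2, -, h4⟩ := hξ
  have e1 := h4 p hp a b c
  have e2 := h4 p hp a c b
  have hT : ∀ d, pd d (fun q => polarizedTorsion D S q a b c) p =
      pd d (fun q => connection (godelMetric H D) (polarizedTorsion D S) q a b c) p -
      pd d (fun q => connection (godelMetric H D) (polarizedTorsion D S) q a c b) p := fun d => by
    rw [← pd_sub d (B.differentiableAt_connection hp a b c)
      (B.differentiableAt_connection hp a c b)]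
    exact pd_congr_on (isOpen_box B.isOpen) hp d fun q hq => B.connection_sub_swap hq a b c
  simp only [hT]
  simp only [B.connection_sub_swap hp]
  unfold lieConnection at e1 e2
  rw [pd_comm c b (contDiffAt_component (h2 p hp) a)] at e2
  simp only [Fin.sum_univ_four] at e1 e2 ⊢
  linear_combination e1 - e2

/-- The Killing equations of the Gödel-type metric in coordinates. -/
theorem killing_equations (B : IsGodelBackground I H D S)
    (hξ : ξ ∈ godelMotions (Set.univ.pi I) H D S) (hp : p ∈ Set.univ.pi I) :
    (pd 0 (fun q => ξ q 0) p + H (p 1) * pd 0 (fun q => ξ q 2) p = 0) ∧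
    pd 1 (fun q => ξ q 1) p = 0 ∧
    pd 3 (fun q => ξ q 3) p = 0 ∧
    pd 1 (fun q => ξ q 3) p + pd 3 (fun q => ξ q 1) p = 0 ∧
    pd 1 (fun q => ξ q 0) p + H (p 1) * pd 1 (fun q => ξ q 2) p - pd 0 (fun q => ξ q 1) p = 0 ∧
    pd 3 (fun q => ξ q 0) p + H (p 1) * pd 3 (fun q => ξ q 2) p - pd 0 (fun q => ξ q 3) p = 0 ∧
    ξ p 1 * deriv H (p 1) + pd 2 (fun q => ξ q 0) p + H (p 1) * pd 2 (fun q => ξ q 2) p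
      + H (p 1) * pd 0 (fun q => ξ q 0) p
      + (H (p 1) ^ 2 - D (p 1) ^ 2) * pd 0 (fun q => ξ q 2) p = 0 ∧
    ξ p 1 * (H (p 1) * deriv H (p 1) - D (p 1) * deriv D (p 1))
      + H (p 1) * pd 2 (fun q => ξ q 0) p
      + (H (p 1) ^ 2 - D (p 1) ^ 2) * pd 2 (fun q => ξ q 2) p = 0 ∧
    H (p 1) * pd 1 (fun q => ξ q 0) p + (H (p 1) ^ 2 - D (p 1) ^ 2) * pd 1 (fun q => ξ q 2) p
      - pd 2 (fun q => ξ q 1) p = 0 ∧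
    H (p 1) * pd 3 (fun q => ξ q 0) p + (H (p 1) ^ 2 - D (p 1) ^ 2) * pd 3 (fun q => ξ q 2) p
      - pd 2 (fun q => ξ q 3) p = 0 := by
  obtain ⟨-, -, h3, -⟩ := hξ
  have hg := fun d a b => pd_godelMetric (B.hasDerivAt_H (hp 1 trivial)).differentiableAt
    (B.hasDerivAt_D (hp 1 trivial)).differentiableAt d a b
  have h := h3 p hp
  simp only [lieMetric, hg, Fin.sum_univ_four] at h
  simp only [forall_fin_four, godelMetric, godelMetricDeriv, Matrix.of_apply, Matrix.cons_val',
    Matrix.cons_val, zero_ne_one, Fin.reduceEq, if_true, if_false, mul_zero, zero_mul,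
    add_zero, zero_add] at h
  obtain ⟨⟨h00, h01, h02, h03⟩, ⟨-, h11, h12, h13⟩, ⟨-, -, h22, h23⟩, -, -, -, h33⟩ := h
  refine ⟨?_, ?_, ?_, ?_, ?_, ?_, ?_, ?_, ?_, ?_⟩ <;> linarith

/-- Otherwise $SS'=0$ everywhere, so $S^2$ is constant on the interval. If the constant is $0$ then
$S=0$; if not, $S$ has no zero and $S'=0$. Either way $S$ would be constant. -/
theorem exists_S_ne_zero_deriv_ne_zero (B : IsGodelBackground I H D S)
    (hne : (I 3).Nonempty) (hS : ¬ ∃ c, ∀ z ∈ I 3, S z = c) :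
    ∃ z ∈ I 3, S z ≠ 0 ∧ deriv S z ≠ 0 := by
  by_contra! hcon
  have hsq : ∀ z ∈ I 3, HasDerivAt (fun z => S z ^ 2) 0 z := fun z hz => by
    refine ((B.hasDerivAt_S hz).pow 2).congr_deriv ?_
    by_cases h : S z = 0
    · simp [h]
    · simp [hcon z hz h]
  obtain ⟨z₀, hz₀⟩ := hne
  have hc : ∀ z ∈ I 3, S z ^ 2 = S z₀ ^ 2 := fun z hz =>
    eq_of_deriv_eq_zero_on (B.ordConnected 3) hsq hz hz₀
  refine hS ⟨S z₀, fun z hz => ?_⟩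
  by_cases h0 : S z₀ = 0
  · have := hc z hz
    rw [h0] at this ⊢
    simpa using this
  · refine eq_of_deriv_eq_zero_on (B.ordConnected 3) (fun r hr => ?_) hz hz₀
    have hr0 : S r ≠ 0 := fun h => h0 (by
      have := hc r hr
      rw [h] at this
      simpa using this.symm)
    simpa [hcon r hr hr0] using B.hasDerivAt_S hr

/-- The components $(x;xy)$ and $(y;xy)$ of $\mathcal L_\xi T=0$ are $-DS\,\partial_t\xi^x$ and
$-DS\,\partial_t\xi^y$. In the component $(t;xy)$ the Killing equations make $\partial_t\xi^t$ and
$\partial_x\xi^x$ vanish and cancel $\xi^xD'S$ against $DS\,\partial_y\xi^y$, so that only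
$\xi^zDS'$ is left. -/
theorem static_of_S_ne_zero (B : IsGodelBackground I H D S)
    (hξ : ξ ∈ godelMotions (Set.univ.pi I) H D S) (hp : p ∈ Set.univ.pi I)
    (hS0 : S (p 3) ≠ 0) (hS1 : deriv S (p 3) ≠ 0) :
    ξ p 3 = 0 ∧ pd 0 (fun q => ξ q 0) p = 0 ∧ pd 0 (fun q => ξ q 1) p = 0 ∧
      pd 0 (fun q => ξ q 2) p = 0 := by
  have hD0 := B.D_ne_zero _ (hp 1 trivial)
  obtain ⟨k1, k2, -, -, -, -, k7, k8, -, -⟩ := B.killing_equations hξ hp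
  have t1 := B.lieTorsion_eq_zero hξ hp 1 1 2
  have t2 := B.lieTorsion_eq_zero hξ hp 2 1 2
  have t0 := B.lieTorsion_eq_zero hξ hp 0 1 2
  have hT : ∀ d, pd d (fun q => D (q 1) * S (q 3)) p =
      (if d = 1 then deriv D (p 1) else 0) * S (p 3)
        + D (p 1) * (if d = 3 then deriv S (p 3) else 0) := fun d => by
    have d1 := (B.hasDerivAt_D (hp 1 trivial)).differentiableAt
    have d3 := (B.hasDerivAt_S (hp 3 trivial)).differentiableAt
    rw [pd_mul d (differentiableAt_coord 1 d1) (differentiableAt_coord 3 d3), pd_coord d 1 d1, pd_coord d 3 d3]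
  simp only [polarizedTorsion, Fin.sum_univ_four, zero_ne_one, one_ne_zero, Fin.reduceEq,
    and_true, and_false, false_and, true_and, and_self, if_true, if_false, pd_const, hT, mul_zero,
    zero_mul, add_zero, zero_add, sub_zero, zero_sub, neg_zero, neg_eq_zero, mul_eq_zero, hD0, hS0,
    false_or] at t0 t1 t2
  have a0 : pd 0 (fun q => ξ q 0) p = 0 := by rw [t2] at k1; linarith
  rw [a0, t2] at k7
  -- $H$ times the $ty$ Killing equation minus the $yy$ one eliminates $\partial_y\xi^t$; a common
  -- factor $D$ is then cancelled.
  have hY : D (p 1) * pd 2 (fun q => ξ q 2) p = -(ξ p 1 * deriv D (p 1)) := by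
    refine mul_left_cancel₀ hD0 ?_
    linear_combination H (p 1) * k7 - k8
  refine ⟨?_, a0, t1, t2⟩
  have : ξ p 3 * (D (p 1) * deriv S (p 3)) = 0 := by
    rw [a0, k2] at t0
    linear_combination t0 - S (p 3) * hY
  simpa [hD0, hS1] using this

end IsGodelBackground

end

/-! ### Independence of $t$ and $z$, and reduction to a profile -/

section

variable {I : Fin 4 → Set ℝ} {H D S : ℝ → ℝ} {ξ : Pt → Pt} {p : Pt}

theorem differentiableAt_component_of_mem_motions {M : Set Pt}
    {g : Pt → Matrix (Fin 4) (Fin 4) ℝ} {Γ : Pt → Fin 4 → Fin 4 → Fin 4 → ℝ}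
    (hξ : ξ ∈ motions M g Γ) (hp : p ∈ M) (a : Fin 4) :
    DifferentiableAt ℝ (fun q => ξ q a) p :=
  (contDiffAt_component (hξ.2.1 p hp) a).differentiableAt (by simp)

namespace IsGodelBackground

/-- The vanishing on a slice with $S\ne0$, $S'\ne0$ spreads along the $z$-lines because
$\partial_z\xi^z=0$. -/
theorem apply_three_eq_zero (B : IsGodelBackground I H D S)
    (hSconst : ¬ ∃ c, ∀ z ∈ I 3, S z = c)
    (hξ : ξ ∈ godelMotions (Set.univ.pi I) H D S) (hp : p ∈ Set.univ.pi I) : ξ p 3 = 0 := by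
  obtain ⟨z, hz, hS0, hS1⟩ := B.exists_S_ne_zero_deriv_ne_zero ⟨p 3, hp 3 trivial⟩ hSconst
  have h1 := B.static_of_S_ne_zero hξ (update_mem_box hp hz) (by simpa using hS0)
    (by simpa using hS1)
  rw [← h1.1]
  exact (update_eq_of_pd_eq_zero (f := fun q => ξ q 3) B.ordConnected hp
    (fun s hs => differentiableAt_component_of_mem_motions hξ (update_mem_box hp hs) 3)
    (fun s hs => (B.killing_equations hξ (update_mem_box hp hs)).2.2.1) hz).symm

/-- With $\xi^z=0$, the $tz$ and $yz$ Killing equations are a homogeneous linear system in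
$\partial_z\xi^t,\partial_z\xi^y$ of determinant $-D^2\ne0$. -/
theorem pd_three_eq_zero (B : IsGodelBackground I H D S)
    (hSconst : ¬ ∃ c, ∀ z ∈ I 3, S z = c)
    (hξ : ξ ∈ godelMotions (Set.univ.pi I) H D S) (hp : p ∈ Set.univ.pi I) (a : Fin 4) :
    pd 3 (fun q => ξ q a) p = 0 := by
  have hD0 := B.D_ne_zero _ (hp 1 trivial)
  have hZ : ∀ i, pd i (fun q => ξ q 3) p = 0 := fun i => by
    rw [pd_congr_on (isOpen_box B.isOpen) hp i
      fun q hq => B.apply_three_eq_zero hSconst hξ hq, pd_const]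
  obtain ⟨-, -, -, k4, -, k6, -, -, -, k10⟩ := B.killing_equations hξ hp
  simp only [hZ, sub_zero, zero_add] at k4 k6 k10
  have hY : pd 3 (fun q => ξ q 2) p = 0 := by
    have : D (p 1) ^ 2 * pd 3 (fun q => ξ q 2) p = 0 := by
      linear_combination H (p 1) * k6 - k10
    simpa [hD0] using this
  rw [hY, mul_zero, add_zero] at k6
  revert a
  exact forall_fin_four.2 ⟨k6, k4, hY, hZ 3⟩

theorem update_three (B : IsGodelBackground I H D S)
    (hSconst : ¬ ∃ c, ∀ z ∈ I 3, S z = c)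
    (hξ : ξ ∈ godelMotions (Set.univ.pi I) H D S) (hp : p ∈ Set.univ.pi I) (a : Fin 4)
    {z : ℝ} (hz : z ∈ I 3) : ξ (update p 3 z) a = ξ p a :=
  update_eq_of_pd_eq_zero (f := fun q => ξ q a) B.ordConnected hp
    (fun _ hs => differentiableAt_component_of_mem_motions hξ (update_mem_box hp hs) a)
    (fun _ hs => B.pd_three_eq_zero hSconst hξ (update_mem_box hp hs) a) hz

/-- Stationarity is known directly only on slices where $S$ and $S'$ do not vanish. Independence of
$z$ allows the $t$-line to be moved into such a slice and back. -/
theorem update_zero (B : IsGodelBackground I H D S)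
    (hSconst : ¬ ∃ c, ∀ z ∈ I 3, S z = c)
    (hξ : ξ ∈ godelMotions (Set.univ.pi I) H D S) (hp : p ∈ Set.univ.pi I) (a : Fin 4)
    {t : ℝ} (ht : t ∈ I 0) : ξ (update p 0 t) a = ξ p a := by
  obtain ⟨z, hz, hS0, hS1⟩ := B.exists_S_ne_zero_deriv_ne_zero ⟨p 3, hp 3 trivial⟩ hSconst
  have hpz := update_mem_box hp hz
  rw [← B.update_three hSconst hξ (update_mem_box hp ht) a hz,
    update_comm (show (0 : Fin 4) ≠ 3 by decide), ← B.update_three hSconst hξ hp a hz]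
  refine update_eq_of_pd_eq_zero (f := fun q => ξ q a) B.ordConnected hpz
    (fun s hs => differentiableAt_component_of_mem_motions hξ (update_mem_box hpz hs) a)
    (fun s hs => ?_) ht
  have hq := update_mem_box hpz hs
  have h1 := B.static_of_S_ne_zero hξ hq (by simpa [update] using hS0)
    (by simpa [update] using hS1)
  have h3 : pd 0 (fun q => ξ q 3) (update (update p 3 z) 0 s) = 0 := by
    rw [pd_congr_on (isOpen_box B.isOpen) hq 0
      fun q hq => B.apply_three_eq_zero hSconst hξ hq, pd_const]
  revert a
  exact forall_fin_four.2 ⟨h1.2.1, h1.2.2.1, h1.2.2.2, h3⟩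

theorem pd_zero_eq_zero (B : IsGodelBackground I H D S)
    (hSconst : ¬ ∃ c, ∀ z ∈ I 3, S z = c)
    (hξ : ξ ∈ godelMotions (Set.univ.pi I) H D S) (hp : p ∈ Set.univ.pi I) (a : Fin 4) :
    pd 0 (fun q => ξ q a) p = 0 :=
  pd_eq_zero_of_update_eq B.isOpen hp (differentiableAt_component_of_mem_motions hξ hp a)
    fun _ ht => B.update_zero hSconst hξ hp a ht

/-- The `x`-component of an affine-isometric motion is a function of `y` alone. -/
theorem apply_one_eq (B : IsGodelBackground I H D S)
    (hSconst : ¬ ∃ c, ∀ z ∈ I 3, S z = c)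
    (hξ : ξ ∈ godelMotions (Set.univ.pi I) H D S) {P : Pt} (hP : P ∈ Set.univ.pi I)
    (hp : p ∈ Set.univ.pi I) : ξ p 1 = ξ (update P 2 (p 2)) 1 := by
  have h0 := update_mem_box hp (hP 0 trivial)
  have h1 := update_mem_box h0 (hP 1 trivial)
  have e : update P 2 (p 2) = update (update (update p 0 (P 0)) 1 (P 1)) 3 (P 3) := by
    ext i; revert i; simp [forall_fin_four, update]
  rw [e, B.update_three hSconst hξ h1 1 (hP 3 trivial), ← B.update_zero hSconst hξ hp 1
    (hP 0 trivial)]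
  exact (update_eq_of_pd_eq_zero (f := fun q => ξ q 1) B.ordConnected h0
    (fun s hs => differentiableAt_component_of_mem_motions hξ (update_mem_box h0 hs) 1)
    (fun s hs => (B.killing_equations hξ (update_mem_box h0 hs)).2.1) (hP 1 trivial)).symm

/-- With $t$- and $z$-derivatives gone, the $tx$ and $xy$ Killing equations give the $x$-derivatives
of $\xi^t,\xi^y$, and the $ty$ and $yy$ equations give their $y$-derivatives. Both differential
conditions on the profile are integrability conditions. -/
theorem isGodelField (B : IsGodelBackground I H D S)
    (hSconst : ¬ ∃ c, ∀ z ∈ I 3, S z = c)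
    (hξ : ξ ∈ godelMotions (Set.univ.pi I) H D S) {P : Pt} (hP : P ∈ Set.univ.pi I) :
    IsGodelField I H D (fun y => ξ (update P 2 y) 1) ξ := by
  set h : ℝ → ℝ := fun y => ξ (update P 2 y) 1 with hdef
  have hh : ContDiffOn ℝ ∞ h (I 2) := fun y hy => by
    have h1 := contDiffAt_component (hξ.2.1 _ (update_mem_box hP hy)) 1
    have h2 : ContDiffAt ℝ ∞ (fun y => update P 2 y) y :=
      (contDiff_update ∞ P 2).contDiffAt
    exact (ContDiffAt.comp (g := fun q => ξ q 1) y h1 h2).contDiffWithinAt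
  have hX : ∀ q ∈ Set.univ.pi I, ξ q 1 = h (q 2) := fun q hq => B.apply_one_eq hSconst hξ hP hq
  have hX2 : ∀ q ∈ Set.univ.pi I, pd 2 (fun q => ξ q 1) q = deriv h (q 2) := fun q hq => by
    rw [pd_congr_on (isOpen_box B.isOpen) hq 2 hX, pd_coord 2 2
      (hasDerivAt_of_contDiffOn (B.isOpen 2) hh (hq 2 trivial)).differentiableAt, if_pos rfl]
  have hYA : ∀ q ∈ Set.univ.pi I,
      pd 1 (fun q => ξ q 2) q = -1 / D (q 1) ^ 2 * deriv h (q 2) ∧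
      pd 2 (fun q => ξ q 2) q = -(deriv D (q 1) / D (q 1)) * h (q 2) ∧
      pd 1 (fun q => ξ q 0) q = H (q 1) / D (q 1) ^ 2 * deriv h (q 2) ∧
      pd 2 (fun q => ξ q 0) q =
        (-deriv H (q 1) + H (q 1) * (deriv D (q 1) / D (q 1))) * h (q 2) := fun q hq => by
    have hD0 := B.D_ne_zero _ (hq 1 trivial)
    obtain ⟨-, -, -, -, k5, -, k7, k8, k9, -⟩ := B.killing_equations hξ hq
    simp only [B.pd_zero_eq_zero hSconst hξ hq, hX2 q hq, hX q hq, mul_zero, add_zero,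
      sub_zero] at k5 k7 k8 k9
    have y1 : pd 1 (fun q => ξ q 2) q = -1 / D (q 1) ^ 2 * deriv h (q 2) := by
      field_simp
      linear_combination H (q 1) * k5 - k9
    have y2 : pd 2 (fun q => ξ q 2) q = -(deriv D (q 1) / D (q 1)) * h (q 2) := by
      have : D (q 1) * pd 2 (fun q => ξ q 2) q = -(h (q 2) * deriv D (q 1)) :=
        mul_left_cancel₀ hD0 (by linear_combination H (q 1) * k7 - k8)
      field_simp
      linear_combination this
    refine ⟨y1, y2, ?_, ?_⟩
    · rw [y1] at k5
      linear_combination k5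
    · rw [y2] at k7
      linear_combination k7
  have hpd2 : ∀ q ∈ Set.univ.pi I, ∀ i, pd i (fun q => ξ q 2) q =
      if i = 1 then -1 / D (q 1) ^ 2 * deriv h (q 2)
      else if i = 2 then -(deriv D (q 1) / D (q 1)) * h (q 2) else 0 := fun q hq => by
    simp [forall_fin_four, hYA q hq, B.pd_zero_eq_zero hSconst hξ hq,
      B.pd_three_eq_zero hSconst hξ hq]
  have hpd0 : ∀ q ∈ Set.univ.pi I, ∀ i, pd i (fun q => ξ q 0) q =
      if i = 1 then H (q 1) / D (q 1) ^ 2 * deriv h (q 2)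
      else if i = 2 then (-deriv H (q 1) + H (q 1) * (deriv D (q 1) / D (q 1))) * h (q 2)
      else 0 := fun q hq => by
    simp [forall_fin_four, hYA q hq, B.pd_zero_eq_zero hSconst hξ hq,
      B.pd_three_eq_zero hSconst hξ hq]
  have hode : ∀ x ∈ I 1, ∀ y ∈ I 2,
      deriv (deriv h) y = h y * (D x * deriv (deriv D) x - deriv D x ^ 2) ∧
      h y * (D x * deriv (deriv H) x - deriv D x * deriv H x) = 0 := fun x hx y hy => by
    have hq := update_mem_box (update_mem_box hP hx) hy
    set q := update (update P 1 x) 2 y with hqdef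
    have q1 : q 1 = x := by simp [hqdef, update]
    have q2 : q 2 = y := by simp [hqdef]
    have hD0 := B.D_ne_zero x hx
    have e2 := pd_pd_of_pd_eq B hh hq hpd2 (B.hasDerivAt_neg_inv_sq (hq 1 trivial))
      (B.hasDerivAt_neg_logDeriv (hq 1 trivial))
    have e0 := pd_pd_of_pd_eq B hh hq hpd0 (B.hasDerivAt_H_div_sq (hq 1 trivial))
      (B.hasDerivAt_shear (hq 1 trivial))
    -- Mixed partials of $\xi^y$ give the equation for $h''$; those of $\xi^t$, after inserting it,
    -- give $h\,(DH''-D'H')=0$.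
    have c2 := pd_comm 1 2 (contDiffAt_component (hξ.2.1 _ hq) 2)
    have c0 := pd_comm 1 2 (contDiffAt_component (hξ.2.1 _ hq) 0)
    simp only [e2, e0, q1, q2, Fin.reduceEq, if_true, if_false] at c2 c0
    have r : deriv (deriv h) y = h y * (D x * deriv (deriv D) x - deriv D x ^ 2) := by
      field_simp at c2
      linear_combination c2
    refine ⟨r, ?_⟩
    rw [r] at c0
    field_simp at c0
    refine mul_left_cancel₀ hD0 ?_
    linear_combination -c0
  exact
    { zero_off := hξ.1
      smooth := hξ.2.1
      smooth_profile := hh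
      apply_three := fun q hq => B.apply_three_eq_zero hSconst hξ hq
      apply_one := hX
      pd_two := hpd2
      pd_zero := hpd0
      profile_ode := fun x hx y hy => (hode x hx y hy).1
      profile_mul := fun x hx y hy => (hode x hx y hy).2 }

end IsGodelBackground

end

/-! ### Solving the reduced system -/

section

variable {I : Fin 4 → Set ℝ} {H D S : ℝ → ℝ} {ξ : Pt → Pt} {p : Pt}

theorem exists_antideriv {J : Set ℝ} (hJ : IsOpen J) (hc : J.OrdConnected) {f : ℝ → ℝ}
    (hf : ContDiffOn ℝ ∞ f J) {x₀ : ℝ} (hx₀ : x₀ ∈ J) :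
    ∃ V : ℝ → ℝ, V x₀ = 0 ∧ ContDiffOn ℝ ∞ V J ∧ ∀ x ∈ J, HasDerivAt V (f x) x := by
  have hV : ∀ x ∈ J, HasDerivAt (fun x => ∫ r in x₀..x, f r) (f x) x := fun x hx =>
    intervalIntegral.integral_hasDerivAt_right
      ((hf.continuousOn.mono (hc.uIcc_subset hx₀ hx)).intervalIntegrable)
      (hf.continuousOn.stronglyMeasurableAtFilter hJ x hx)
      (hf.continuousOn.continuousAt (hJ.mem_nhds hx))
  refine ⟨fun x => ∫ r in x₀..x, f r, intervalIntegral.integral_same, ?_, hV⟩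
  refine (contDiffOn_infty_iff_deriv_of_isOpen hJ).2
    ⟨fun x hx => (hV x hx).differentiableAt.differentiableWithinAt, ?_⟩
  exact hf.congr fun x hx => (hV x hx).deriv

/-- Smooth fundamental solutions of `u'' = k u` with their antiderivative. -/
theorem exists_fundamental_solutions (k : ℝ) : ∃ s c e : ℝ → ℝ,
    ContDiff ℝ ∞ s ∧ ContDiff ℝ ∞ c ∧ ContDiff ℝ ∞ e ∧ s 0 = 0 ∧ c 0 = 1 ∧ e 0 = 0 ∧
    (∀ y, HasDerivAt s (c y) y) ∧ (∀ y, HasDerivAt c (k * s y) y) ∧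
    (∀ y, HasDerivAt e (s y) y) ∧ (∀ y, c y = k * e y + 1) ∧
    ∀ y, c y ^ 2 - k * s y ^ 2 = 1 := by
  rcases lt_trichotomy k 0 with hk | rfl | hk
  · obtain ⟨a, ha, rfl⟩ : ∃ a : ℝ, a ≠ 0 ∧ k = -a ^ 2 :=
      ⟨√(-k), (Real.sqrt_pos.2 (by linarith)).ne', by rw [Real.sq_sqrt (by linarith)]; ring⟩
    have hl : ∀ y, HasDerivAt (fun y => a * y) a y := fun y => by
      simpa using (hasDerivAt_id y).const_mul a
    refine ⟨fun y => Real.sin (a * y) / a, fun y => Real.cos (a * y),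
      fun y => (1 - Real.cos (a * y)) / a ^ 2, by fun_prop, by fun_prop, by fun_prop, by simp,
      by simp, by simp, fun y => ?_, fun y => ?_, fun y => ?_, fun y => ?_, fun y => ?_⟩
    · exact ((hl y).sin.div_const a).congr_deriv (by field_simp)
    · exact (hl y).cos.congr_deriv (by field_simp)
    · exact (((hl y).cos.const_sub 1).div_const (a ^ 2)).congr_deriv (by field_simp)
    · field_simp; ring
    · field_simp; linarith [Real.sin_sq_add_cos_sq (a * y)]
  · refine ⟨fun y => y, fun _ => 1, fun y => y ^ 2 / 2, by fun_prop, by fun_prop, by fun_prop,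
      rfl, rfl, by simp, fun y => hasDerivAt_id y, fun y => ?_, fun y => ?_, by simp, by simp⟩
    · exact (hasDerivAt_const y (1 : ℝ)).congr_deriv (by simp)
    · exact ((hasDerivAt_pow 2 y).div_const 2).congr_deriv (by simp)
  · obtain ⟨a, ha, rfl⟩ : ∃ a : ℝ, a ≠ 0 ∧ k = a ^ 2 :=
      ⟨√k, (Real.sqrt_pos.2 hk).ne', (Real.sq_sqrt hk.le).symm⟩
    have hl : ∀ y, HasDerivAt (fun y => a * y) a y := fun y => by
      simpa using (hasDerivAt_id y).const_mul a
    refine ⟨fun y => Real.sinh (a * y) / a, fun y => Real.cosh (a * y),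
      fun y => (Real.cosh (a * y) - 1) / a ^ 2, by fun_prop, by fun_prop, by fun_prop, by simp,
      by simp, by simp, fun y => ?_, fun y => ?_, fun y => ?_, fun y => ?_, fun y => ?_⟩
    · exact ((hl y).sinh.div_const a).congr_deriv (by field_simp)
    · exact (hl y).cosh.congr_deriv (by field_simp)
    · exact (((hl y).cosh.sub_const 1).div_const (a ^ 2)).congr_deriv (by field_simp)
    · field_simp; ring
    · field_simp; linarith [Real.cosh_sq (a * y)]

/-- Uniqueness without a general ODE theorem: $hc-h's$ and $h'c-k\,hs$ are constant, hence zero by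
the initial data, and $c^2-ks^2=1$ allows solving for $h$. -/
theorem eq_zero_of_deriv_deriv_eq {J : Set ℝ} (hJ : IsOpen J) (hc : J.OrdConnected) {h : ℝ → ℝ}
    (hh : ContDiffOn ℝ ∞ h J) {k : ℝ} (hode : ∀ y ∈ J, deriv (deriv h) y = k * h y)
    {y₀ : ℝ} (hy₀ : y₀ ∈ J) (h0 : h y₀ = 0) (h1 : deriv h y₀ = 0) : ∀ y ∈ J, h y = 0 := by
  obtain ⟨s, c, -, -, -, -, -, -, -, hs, hc', -, -, hsc⟩ := exists_fundamental_solutions k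
  have d0 := fun y hy => hasDerivAt_of_contDiffOn hJ hh (x := y) hy
  have d1 := fun y hy => hasDerivAt_of_contDiffOn hJ (contDiffOn_deriv hJ hh) (x := y) hy
  have e1 : ∀ y ∈ J, HasDerivAt (fun y => h y * c y - deriv h y * s y) 0 y := fun y hy =>
    (((d0 y hy).mul (hc' y)).sub ((d1 y hy).mul (hs y))).congr_deriv (by
      rw [hode y hy]; ring)
  have e2 : ∀ y ∈ J, HasDerivAt (fun y => deriv h y * c y - k * (h y * s y)) 0 y := fun y hy =>
    (((d1 y hy).mul (hc' y)).sub (((d0 y hy).mul (hs y)).const_mul k)).congr_deriv (by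
      rw [hode y hy]; ring)
  intro y hy
  have g1 := eq_of_deriv_eq_zero_on hc e1 hy hy₀
  have g2 := eq_of_deriv_eq_zero_on hc e2 hy hy₀
  simp only [h0, h1, zero_mul, mul_zero, sub_zero] at g1 g2
  linear_combination c y * g1 + s y * g2 - h y * hsc y

theorem pd_coord_mul_coord_add {u v w : ℝ → ℝ} {p : Pt} {u' v' w' : ℝ} (r : ℝ) (i : Fin 4)
    (hu : HasDerivAt u u' (p 1)) (hv : HasDerivAt v v' (p 2)) (hw : HasDerivAt w w' (p 1)) :
    pd i (fun q => u (q 1) * v (q 2) + r * w (q 1)) p =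
      if i = 1 then u' * v (p 2) + r * w' else if i = 2 then u (p 1) * v' else 0 := by
  have hu' := differentiableAt_coord 1 hu.differentiableAt
  have hv' := differentiableAt_coord 2 hv.differentiableAt
  have hw' := differentiableAt_coord 1 hw.differentiableAt
  have e : pd i (fun q => u (q 1) * v (q 2) + r * w (q 1)) p =
      pd i (fun q => u (q 1) * v (q 2)) p + r * pd i (fun q => w (q 1)) p := by
    unfold pd
    rw [fderiv_fun_add (hu'.fun_mul hv') (hw'.const_mul r), fderiv_const_mul hw']
    rfl
  rw [e, pd_coord_mul_coord i hu hv, pd_coord i 1 hw.differentiableAt, hw.deriv]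
  by_cases h1 : i = 1
  · simp [h1]
  · simp [h1]

theorem contDiffAt_coord {f : ℝ → ℝ} (j : Fin 4) (hf : ContDiffAt ℝ ∞ f (p j)) :
    ContDiffAt ℝ ∞ (fun q : Pt => f (q j)) p :=
  ContDiffAt.comp (g := f) p hf (by fun_prop)

/-- Here $F$ is the antiderivative of $h$ vanishing at $y_P$, and $h'=kF+c$ is the once-integrated
equation $h''=kh$, so $c=h'(y_P)$. The $y$-integration of the gradients produces the terms in $F$;
the rest is $c$ times functions of $x$ alone, normalized to vanish at $x_P$. This is why $\xi^t$ and
$\xi^y$ vanish on all of $y=y_P$ when $c=0$, and on $x=x_P,\ y=y_P$ in general. -/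
theorem IsGodelBackground.exists_isGodelField (B : IsGodelBackground I H D S) {P : Pt}
    (hP : P ∈ Set.univ.pi I) {h F : ℝ → ℝ} {k c : ℝ} (hh : ContDiff ℝ ∞ h) (hF : ContDiff ℝ ∞ F)
    (hF' : ∀ y, HasDerivAt F (h y) y) (hh' : ∀ y, HasDerivAt h (k * F y + c) y)
    (hF0 : F (P 2) = 0)
    (hK : ∀ x ∈ I 1, D x * deriv (deriv D) x - deriv D x ^ 2 = k)
    (hHD : ∀ x ∈ I 1, D x * deriv (deriv H) x - deriv D x * deriv H x = 0) :
    ∃ ξ, IsGodelField I H D h ξ ∧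
      ∀ q ∈ Set.univ.pi I, q 2 = P 2 → c = 0 ∨ q 1 = P 1 → ξ q 0 = 0 ∧ ξ q 2 = 0 := by
  have hM := isOpen_box B.isOpen
  have hD' := contDiffOn_deriv (B.isOpen 1) B.contDiffOn_D
  have hH' := contDiffOn_deriv (B.isOpen 1) B.contDiffOn_H
  have hDsq : ∀ x ∈ I 1, D x ^ 2 ≠ 0 := fun x hx => pow_ne_zero 2 (B.D_ne_zero x hx)
  obtain ⟨V, hV0, hV, hV'⟩ := exists_antideriv (B.isOpen 1) (B.ordConnected 1)
    (f := fun x => -1 / D x ^ 2) (contDiffOn_const.div (B.contDiffOn_D.pow 2) hDsq) (hP 1 trivial)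
  obtain ⟨W, hW0, hW, hW'⟩ := exists_antideriv (B.isOpen 1) (B.ordConnected 1)
    (f := fun x => H x / D x ^ 2) (B.contDiffOn_H.div (B.contDiffOn_D.pow 2) hDsq) (hP 1 trivial)
  set Y : Pt → ℝ := fun q => -(deriv D (q 1) / D (q 1)) * F (q 2) + c * V (q 1) with hY
  set A : Pt → ℝ := fun q =>
    (-deriv H (q 1) + H (q 1) * (deriv D (q 1) / D (q 1))) * F (q 2) + c * W (q 1) with hA
  set ξ : Pt → Pt := Set.indicator (Set.univ.pi I) fun q => ![A q, h (q 2), Y q, 0] with hξ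
  have hξM : ∀ q ∈ Set.univ.pi I, ξ q = ![A q, h (q 2), Y q, 0] := fun q hq =>
    Set.indicator_of_mem hq _
  have hξ0 : ∀ q ∈ Set.univ.pi I, ξ q 0 = A q := fun q hq => by rw [hξM q hq]; rfl
  have hξ2 : ∀ q ∈ Set.univ.pi I, ξ q 2 = Y q := fun q hq => by rw [hξM q hq]; rfl
  have dh : ∀ y, deriv h y = k * F y + c := fun y => (hh' y).deriv
  refine ⟨ξ, ⟨fun q hq => Set.indicator_of_notMem hq _, fun q hq => ?_, hh.contDiffOn,
    fun q hq => by rw [hξM q hq]; rfl, fun q hq => by rw [hξM q hq]; rfl, fun q hq i => ?_,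
    fun q hq i => ?_, fun x hx y hy => ?_, fun x hx y hy => by rw [hHD x hx, mul_zero]⟩,
    fun q hq h2 h1 => ?_⟩
  · have hq1 := (B.isOpen 1).mem_nhds (hq 1 trivial)
    have s : ∀ {f : ℝ → ℝ}, ContDiffOn ℝ ∞ f (I 1) → ContDiffAt ℝ ∞ (fun q : Pt => f (q 1)) q :=
      fun hf => contDiffAt_coord 1 (hf.contDiffAt hq1)
    have sF : ContDiffAt ℝ ∞ (fun q : Pt => F (q 2)) q := contDiffAt_coord 2 hF.contDiffAt
    have sD := (s hD').div (s B.contDiffOn_D) (B.D_ne_zero _ (hq 1 trivial))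
    have key : ContDiffAt ℝ ∞ (fun q => (![A q, h (q 2), Y q, 0] : Pt)) q := by
      rw [contDiffAt_pi, forall_fin_four]
      exact ⟨(((s hH').neg.add ((s B.contDiffOn_H).mul sD)).mul sF).add
          (contDiffAt_const.mul (s hW)),
        contDiffAt_coord 2 hh.contDiffAt,
        (sD.neg.mul sF).add (contDiffAt_const.mul (s hV)), contDiffAt_const⟩
    exact key.congr_of_eventuallyEq (Filter.eventuallyEq_of_mem (hM.mem_nhds hq) hξM)
  · have hx := hq 1 trivial
    have hD0 := B.D_ne_zero _ hx
    rw [pd_congr_on hM hq i hξ2, hY, pd_coord_mul_coord_add c i (B.hasDerivAt_neg_logDeriv hx)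
      (hF' _) (hV' _ hx), dh, hK _ hx]
    congr 1
    ring
  · have hx := hq 1 trivial
    have hD0 := B.D_ne_zero _ hx
    rw [pd_congr_on hM hq i hξ0, hA, pd_coord_mul_coord_add c i (B.hasDerivAt_shear hx)
      (hF' _) (hW' _ hx), dh, hK _ hx]
    congr 1
    have := hHD _ hx
    field_simp
    linear_combination (-F (q 2) * D (q 1)) * this
  · have e : deriv h = fun y => k * F y + c := funext dh
    rw [e, hK x hx, (((hF' y).const_mul k).add_const c).deriv, mul_comm]
  · rw [hξ0 q hq, hξ2 q hq]
    simp only [hA, hY, h2, hF0, mul_zero, zero_add]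
    rcases h1 with rfl | h1
    · simp
    · simp [h1, hV0, hW0]

end

/-! ### Translations and the generic case -/

section

variable {I : Fin 4 → Set ℝ} {H D S h : ℝ → ℝ} {ξ : Pt → Pt} {p : Pt}

/-- The fields `a ∂ₜ + b ∂_y` on the box, as a linear function of `(a, b)`. -/
noncomputable def translationField (I : Fin 4 → Set ℝ) : (Fin 2 → ℝ) →ₗ[ℝ] (Pt → Pt) where
  toFun v := Set.indicator (Set.univ.pi I) fun _ => ![v 0, 0, v 1, 0]
  map_add' v w := by
    ext q i
    revert i
    by_cases hq : q ∈ Set.univ.pi I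
    · simp only [Pi.add_apply, Set.indicator_of_mem hq, forall_fin_four]
      simp
    · simp only [Pi.add_apply, Set.indicator_of_notMem hq]
      simp
  map_smul' r v := by
    ext q i
    revert i
    by_cases hq : q ∈ Set.univ.pi I
    · simp only [Pi.smul_apply, RingHom.id_apply, Set.indicator_of_mem hq, forall_fin_four]
      simp
    · simp only [Pi.smul_apply, RingHom.id_apply, Set.indicator_of_notMem hq]
      simp

theorem translationField_apply (v : Fin 2 → ℝ) (hp : p ∈ Set.univ.pi I) :
    translationField I v p = ![v 0, 0, v 1, 0] := by
  change Set.indicator (Set.univ.pi I) (fun _ => (![v 0, 0, v 1, 0] : Pt)) p = _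
  exact Set.indicator_of_mem hp _

theorem translationField_of_notMem (v : Fin 2 → ℝ) (hp : p ∉ Set.univ.pi I) :
    translationField I v p = 0 := by
  change Set.indicator (Set.univ.pi I) (fun _ => (![v 0, 0, v 1, 0] : Pt)) p = _
  exact Set.indicator_of_notMem hp _

theorem translationField_injective {P : Pt} (hP : P ∈ Set.univ.pi I) :
    Function.Injective (translationField I) := by
  intro v w hvw
  have e := congrFun hvw P
  rw [translationField_apply v hP, translationField_apply w hP] at e
  ext i
  fin_cases i
  · exact congrFun e 0
  · exact congrFun e 2

theorem isGodelField_translationField (hopen : ∀ i, IsOpen (I i)) (v : Fin 2 → ℝ) :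
    IsGodelField I H D (fun _ => 0) (translationField I v) := by
  have hM := isOpen_box hopen
  have hd : deriv (fun _ : ℝ => (0 : ℝ)) = fun _ => 0 := by ext; simp
  have hc : ∀ q ∈ Set.univ.pi I, ∀ i a, pd i (fun q => translationField I v q a) q = 0 :=
    fun q hq i a => by
      rw [pd_congr_on hM hq i (h := fun _ => (![v 0, 0, v 1, 0] : Pt) a)
        fun r hr => by rw [translationField_apply v hr], pd_const]
  refine ⟨fun q hq => translationField_of_notMem v hq, fun q hq => ?_, contDiffOn_const,
    fun q hq => ?_, fun q hq => ?_, fun q hq i => ?_, fun q hq i => ?_, fun x _ y _ => ?_,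
    fun x _ y _ => zero_mul _⟩
  · exact contDiffAt_const.congr_of_eventuallyEq
      (Filter.eventuallyEq_of_mem (hM.mem_nhds hq) fun r hr => translationField_apply v hr)
  · rw [translationField_apply v hq]; rfl
  · rw [translationField_apply v hq]; rfl
  · simp [hc q hq, hd]
  · simp [hc q hq, hd]
  · simp [hd]

/-- A zero profile annihilates the gradients of $\xi^t$ and $\xi^y$, so both are constant on the
connected box. -/
theorem IsGodelField.eq_translationField (hopen : ∀ i, IsOpen (I i))
    (hconn : ∀ i, (I i).OrdConnected) (F : IsGodelField I H D h ξ) (h0 : ∀ y ∈ I 2, h y = 0)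
    {P : Pt} (hP : P ∈ Set.univ.pi I) : ξ = translationField I ![ξ P 0, ξ P 2] := by
  have hd : ∀ y ∈ I 2, deriv h y = 0 := fun y hy => by
    rw [(Filter.eventuallyEq_of_mem ((hopen 2).mem_nhds hy) h0).deriv_eq, deriv_const]
  have dξ : ∀ a, ∀ q ∈ Set.univ.pi I, DifferentiableAt ℝ (fun q => ξ q a) q := fun a q hq =>
    (contDiffAt_component (F.smooth q hq) a).differentiableAt (by simp)
  ext q i
  by_cases hq : q ∈ Set.univ.pi I
  · rw [translationField_apply _ hq]
    have e0 := eq_of_forall_pd_eq_zero hconn (dξ 0) (fun r hr i => by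
      simp [F.pd_zero r hr, h0 _ (hr 2 trivial), hd _ (hr 2 trivial)]) hq hP
    have e2 := eq_of_forall_pd_eq_zero hconn (dξ 2) (fun r hr i => by
      simp [F.pd_two r hr, h0 _ (hr 2 trivial), hd _ (hr 2 trivial)]) hq hP
    have e1 : ξ q 1 = 0 := by rw [F.apply_one q hq, h0 _ (hq 2 trivial)]
    revert i
    exact forall_fin_four.2 ⟨e0, e1, e2, F.apply_three q hq⟩
  · rw [F.zero_off q hq, translationField_of_notMem _ hq]

/-- A motion with nonvanishing `x`-component forces `H'/D` and `D''/D` to be constant. -/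
theorem IsGodelField.exists_const_of_ne_zero (B : IsGodelBackground I H D S)
    (F : IsGodelField I H D h ξ) {y : ℝ} (hy : y ∈ I 2) (hy0 : h y ≠ 0) {x₀ : ℝ}
    (hx₀ : x₀ ∈ I 1) :
    (∃ c, ∀ x ∈ I 1, deriv H x / D x = c) ∧ ∃ c, ∀ x ∈ I 1, deriv (deriv D) x / D x = c := by
  constructor
  · refine ⟨deriv H x₀ / D x₀, fun x hx => eq_of_deriv_eq_zero_on (B.ordConnected 1)
      (f := fun x => deriv H x / D x) (fun r hr => ?_) hx hx₀⟩
    have hm := (mul_eq_zero.1 (F.profile_mul r hr y hy)).resolve_left hy0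
    refine ((B.hasDerivAt_deriv_H hr).div (B.hasDerivAt_D hr) (B.D_ne_zero r hr)).congr_deriv ?_
    rw [div_eq_zero_iff]
    left
    linear_combination hm
  · set k := deriv (deriv h) y / h y with hk
    have hK : ∀ x ∈ I 1, D x * deriv (deriv D) x - deriv D x ^ 2 = k := fun x hx => by
      rw [hk, F.profile_ode x hx y hy]
      field_simp
    -- This form of $D''/D$ contains no second derivative, so its derivative involves only $D''$;
    -- the numerator there is a multiple of $DD''-D'^2-k$.
    have hD'' : ∀ x ∈ I 1, deriv (deriv D) x / D x = (k + deriv D x ^ 2) / D x ^ 2 :=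
      fun x hx => by
        have hD0 := B.D_ne_zero x hx
        rw [← hK x hx]
        field_simp
        ring
    refine ⟨(k + deriv D x₀ ^ 2) / D x₀ ^ 2, fun x hx => ?_⟩
    rw [hD'' x hx]
    refine eq_of_deriv_eq_zero_on (B.ordConnected 1)
      (f := fun x => (k + deriv D x ^ 2) / D x ^ 2) (fun r hr => ?_) hx hx₀
    have hD0 := B.D_ne_zero r hr
    refine ((((B.hasDerivAt_deriv_D hr).pow 2).const_add k).div ((B.hasDerivAt_D hr).pow 2)
      (pow_ne_zero 2 hD0)).congr_deriv ?_
    have := hK r hr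
    simp only [Nat.cast_ofNat, Nat.reduceSub, pow_one, Pi.pow_apply]
    rw [div_eq_zero_iff]
    left
    linear_combination 2 * D r * deriv D r * this

/-- A single value of $y$ with $h(y)\ne0$ would make both ratios constant, so the profile of every
motion vanishes. -/
theorem godelMotions_eq_range (B : IsGodelBackground I H D S)
    (hSconst : ¬ ∃ c, ∀ z ∈ I 3, S z = c) {P : Pt} (hP : P ∈ Set.univ.pi I)
    (hgen : ¬ ((∃ c, ∀ x ∈ I 1, deriv H x / D x = c) ∧
      ∃ c, ∀ x ∈ I 1, deriv (deriv D) x / D x = c)) :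
    godelMotions (Set.univ.pi I) H D S = LinearMap.range (translationField I) := by
  ext ξ
  rw [LinearMap.mem_range]
  constructor
  · intro hξ
    have F := B.isGodelField hSconst hξ hP
    refine ⟨_, (F.eq_translationField B.isOpen B.ordConnected (fun y hy => ?_) hP).symm⟩
    by_contra hy0
    exact hgen (F.exists_const_of_ne_zero B hy hy0 (hP 1 trivial))
  · rintro ⟨v, rfl⟩
    exact (isGodelField_translationField B.isOpen v).mem_godelMotions B

theorem finrank_godelMotions_generic (B : IsGodelBackground I H D S)
    (hSconst : ¬ ∃ c, ∀ z ∈ I 3, S z = c) {P : Pt} (hP : P ∈ Set.univ.pi I)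
    (hgen : ¬ ((∃ c, ∀ x ∈ I 1, deriv H x / D x = c) ∧
      ∃ c, ∀ x ∈ I 1, deriv (deriv D) x / D x = c)) :
    Module.finrank ℝ (godelMotions (Set.univ.pi I) H D S) = 2 := by
  rw [godelMotions_eq_range B hSconst hP hgen,
    LinearMap.finrank_range_of_inj (translationField_injective hP), Module.finrank_fin_fun]

theorem mem_isotropy {G : Submodule ℝ (Pt → Pt)} {P : Pt} :
    ξ ∈ isotropy G P ↔ ξ ∈ G ∧ ξ P = 0 := by
  simp [isotropy]

theorem isotropy_eq_bot_generic (B : IsGodelBackground I H D S)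
    (hSconst : ¬ ∃ c, ∀ z ∈ I 3, S z = c) {P : Pt} (hP : P ∈ Set.univ.pi I)
    (hgen : ¬ ((∃ c, ∀ x ∈ I 1, deriv H x / D x = c) ∧
      ∃ c, ∀ x ∈ I 1, deriv (deriv D) x / D x = c)) :
    isotropy (godelMotions (Set.univ.pi I) H D S) P = ⊥ := by
  rw [eq_bot_iff]
  intro ξ hξ
  rw [mem_isotropy, godelMotions_eq_range B hSconst hP hgen, LinearMap.mem_range] at hξ
  obtain ⟨⟨v, rfl⟩, h0⟩ := hξ
  rw [translationField_apply v hP] at h0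
  have : v = 0 := by
    ext i
    fin_cases i
    · exact congrFun h0 0
    · exact congrFun h0 2
  rw [this, map_zero]
  exact Submodule.zero_mem _

end

/-! ### The homogeneous profile: four motions and their isotropy -/

section

variable {I : Fin 4 → Set ℝ} {H D S h : ℝ → ℝ} {ξ : Pt → Pt} {p : Pt}

/-- The value at `P` of a motion in the directions `t`, `x`, `y`, together with `∂_y ξ^x (P)`. -/
noncomputable def motionJet {P : Pt} (hP : P ∈ Set.univ.pi I) :
    godelMotions (Set.univ.pi I) H D S →ₗ[ℝ] (Fin 4 → ℝ) where
  toFun ξ := ![ξ.1 P 0, ξ.1 P 1, ξ.1 P 2, pd 2 (fun q => ξ.1 q 1) P]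
  map_add' ξ η := by
    have := pd_add 2 (contDiffAt_component (ξ.2.2.1 P hP) 1)
      (contDiffAt_component (η.2.2.1 P hP) 1)
    ext i
    revert i
    simp [forall_fin_four, this]
  map_smul' r ξ := by
    have := pd_smul 2 r (contDiffAt_component (ξ.2.2.1 P hP) 1)
    ext i
    revert i
    simp [forall_fin_four, this]

/-- The hypotheses that `H' / D` and `D'' / D` are constant, in differentiated form. -/
structure IsHomogeneousProfile (J : Set ℝ) (H D : ℝ → ℝ) (k : ℝ) : Prop where
  curvature : ∀ x ∈ J, D x * deriv (deriv D) x - deriv D x ^ 2 = k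
  rotation : ∀ x ∈ J, D x * deriv (deriv H) x - deriv D x * deriv H x = 0

theorem exists_isHomogeneousProfile (B : IsGodelBackground I H D S) {x₀ : ℝ} (hx₀ : x₀ ∈ I 1)
    {w m2 : ℝ} (hw : ∀ x ∈ I 1, deriv H x / D x = 2 * w)
    (hm : ∀ x ∈ I 1, deriv (deriv D) x / D x = m2) : ∃ k, IsHomogeneousProfile (I 1) H D k := by
  have hH' : ∀ x ∈ I 1, deriv H x = 2 * w * D x := fun x hx =>
    (div_eq_iff (B.D_ne_zero x hx)).1 (hw x hx)
  have hD'' : ∀ x ∈ I 1, deriv (deriv D) x = m2 * D x := fun x hx =>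
    (div_eq_iff (B.D_ne_zero x hx)).1 (hm x hx)
  -- $k$ is the value of the first integral $m^2D^2-D'^2$ of $D''=m^2D$.
  refine ⟨m2 * D x₀ ^ 2 - deriv D x₀ ^ 2, fun x hx => ?_, fun x hx => ?_⟩
  · rw [hD'' x hx]
    rw [show D x * (m2 * D x) - deriv D x ^ 2 = m2 * D x ^ 2 - deriv D x ^ 2 by ring]
    refine eq_of_deriv_eq_zero_on (B.ordConnected 1)
      (f := fun x => m2 * D x ^ 2 - deriv D x ^ 2) (fun r hr => ?_) hx hx₀
    refine ((((B.hasDerivAt_D hr).pow 2).const_mul m2).sub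
      ((B.hasDerivAt_deriv_D hr).pow 2)).congr_deriv ?_
    rw [hD'' r hr]
    norm_num
    ring
  · rw [(Filter.eventuallyEq_of_mem ((B.isOpen 1).mem_nhds hx) hH').deriv_eq,
      ((B.hasDerivAt_D hx).const_mul (2 * w)).deriv, hH' x hx]
    ring

namespace IsHomogeneousProfile

variable {k : ℝ}

/-- The profile is the cosine-like solution with $h(y_P)=1$, $h'(y_P)=0$, that is $c=0$. The field
then equals $\partial_x$ on the whole hypersurface $y=y_P$, as needed to flow in the $x$-direction.
-/
theorem exists_transvection (K : IsHomogeneousProfile (I 1) H D k)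
    (B : IsGodelBackground I H D S) {P : Pt} (hP : P ∈ Set.univ.pi I) :
    ∃ ξ ∈ godelMotions (Set.univ.pi I) H D S,
      (∀ q ∈ Set.univ.pi I, q 2 = P 2 → ξ q = ![0, 1, 0, 0]) ∧ pd 2 (fun q => ξ q 1) P = 0 := by
  obtain ⟨s, c, -, hs, hc, -, s0, c0, -, hs', hc', -, -, -⟩ := exists_fundamental_solutions k
  obtain ⟨ξ, F, hξ⟩ := B.exists_isGodelField hP (h := fun y => c (y - P 2))
    (F := fun y => s (y - P 2)) (k := k) (c := 0) (hc.comp (by fun_prop)) (hs.comp (by fun_prop))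
    (fun y => (hs' _).comp_sub_const y (P 2))
    (fun y => ((hc' _).comp_sub_const y (P 2)).congr_deriv (by ring)) (by simp [s0])
    K.curvature K.rotation
  refine ⟨ξ, F.mem_godelMotions B, fun q hq h2 => ?_, ?_⟩
  · obtain ⟨e0, e2⟩ := hξ q hq h2 (Or.inl rfl)
    have e1 : ξ q 1 = 1 := by rw [F.apply_one q hq, h2, sub_self, c0]
    ext i
    revert i
    exact forall_fin_four.2 ⟨e0, e1, e2, F.apply_three q hq⟩
  · rw [F.pd_one B hP, if_pos rfl, ((hc' _).comp_sub_const (P 2) (P 2)).deriv, sub_self, s0,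
      mul_zero]

/-- The sine-like profile with $h(y_P)=0$, $h'(y_P)=1$ gives the generator of the isotropy algebra.
-/
theorem exists_rotation (K : IsHomogeneousProfile (I 1) H D k)
    (B : IsGodelBackground I H D S) {P : Pt} (hP : P ∈ Set.univ.pi I) :
    ∃ ξ ∈ godelMotions (Set.univ.pi I) H D S, ξ P = 0 ∧ pd 2 (fun q => ξ q 1) P = 1 := by
  obtain ⟨s, c, e, hs, hc, he, s0, c0, e0, hs', hc', he', hce, -⟩ :=
    exists_fundamental_solutions k
  obtain ⟨ξ, F, hξ⟩ := B.exists_isGodelField hP (h := fun y => s (y - P 2))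
    (F := fun y => e (y - P 2)) (k := k) (c := 1) (hs.comp (by fun_prop)) (he.comp (by fun_prop))
    (fun y => (he' _).comp_sub_const y (P 2))
    (fun y => ((hs' _).comp_sub_const y (P 2)).congr_deriv (hce _)) (by simp [e0])
    K.curvature K.rotation
  refine ⟨ξ, F.mem_godelMotions B, ?_, ?_⟩
  · obtain ⟨e0, e2⟩ := hξ P hP rfl (Or.inr rfl)
    have e1 : ξ P 1 = 0 := by rw [F.apply_one P hP, sub_self, s0]
    ext i
    revert i
    exact forall_fin_four.2 ⟨e0, e1, e2, F.apply_three P hP⟩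
  · rw [F.pd_one B hP, if_pos rfl, ((hs' _).comp_sub_const (P 2) (P 2)).deriv, sub_self, c0]

/-- If the jet is zero, the profile has zero Cauchy data for $h''=kh$ and vanishes; the motion is
then a translation field, whose value at $P$ is zero. -/
theorem motionJet_injective (K : IsHomogeneousProfile (I 1) H D k)
    (B : IsGodelBackground I H D S) (hSconst : ¬ ∃ c, ∀ z ∈ I 3, S z = c) {P : Pt}
    (hP : P ∈ Set.univ.pi I) :
    Function.Injective (motionJet hP : godelMotions (Set.univ.pi I) H D S →ₗ[ℝ] _) := by
  rw [← LinearMap.ker_eq_bot, LinearMap.ker_eq_bot']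
  rintro ⟨ξ, hξ⟩ h0
  have F := B.isGodelField hSconst hξ hP
  have j0 : ξ P 0 = 0 := congrFun h0 0
  have j1 : ξ P 1 = 0 := congrFun h0 1
  have j2 : ξ P 2 = 0 := congrFun h0 2
  have j3 : pd 2 (fun q => ξ q 1) P = 0 := congrFun h0 3
  rw [F.pd_one B hP, if_pos rfl] at j3
  rw [F.apply_one P hP] at j1
  have hz := eq_zero_of_deriv_deriv_eq (B.isOpen 2) (B.ordConnected 2) F.smooth_profile (k := k)
    (fun y hy => by
      rw [F.profile_ode _ (hP 1 trivial) y hy, K.curvature _ (hP 1 trivial), mul_comm])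
    (hP 2 trivial) j1 j3
  have e := F.eq_translationField B.isOpen B.ordConnected hz hP
  have z : (![ξ P 0, ξ P 2] : Fin 2 → ℝ) = 0 := by simp [j0, j2]
  rw [z, map_zero] at e
  exact Subtype.ext e

/-- The two translations, the transvection and the rotation at $P$ have the four standard basis
vectors as jets. -/
theorem motionJet_surjective (K : IsHomogeneousProfile (I 1) H D k)
    (B : IsGodelBackground I H D S) {P : Pt} (hP : P ∈ Set.univ.pi I) :
    Function.Surjective (motionJet hP : godelMotions (Set.univ.pi I) H D S →ₗ[ℝ] _) := by
  intro v
  obtain ⟨ξ, hξ, hξv, hξ'⟩ := K.exists_transvection B hP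
  obtain ⟨η, hη, hηv, hη'⟩ := K.exists_rotation B hP
  have T := isGodelField_translationField (H := H) (D := D) B.isOpen ![v 0, v 2]
  let τ : godelMotions (Set.univ.pi I) H D S := ⟨_, T.mem_godelMotions B⟩
  let ξ' : godelMotions (Set.univ.pi I) H D S := ⟨ξ, hξ⟩
  let η' : godelMotions (Set.univ.pi I) H D S := ⟨η, hη⟩
  have jτ : motionJet hP τ = ![v 0, 0, v 2, 0] := by
    have e := translationField_apply ![v 0, v 2] hP
    have e' : pd 2 (fun q => translationField I ![v 0, v 2] q 1) P = 0 := by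
      simp [T.pd_one B hP]
    simp [motionJet, τ, e, e']
  have jξ : motionJet hP ξ' = ![0, 1, 0, 0] := by
    simp [motionJet, ξ', hξv P hP rfl, hξ']
  have jη : motionJet hP η' = ![0, 0, 0, 1] := by
    simp [motionJet, η', hηv, hη']
  refine ⟨τ + v 1 • ξ' + v 3 • η', ?_⟩
  rw [map_add, map_add, map_smul, map_smul, jτ, jξ, jη]
  ext i
  revert i
  simp [forall_fin_four]

theorem finrank_godelMotions (K : IsHomogeneousProfile (I 1) H D k)
    (B : IsGodelBackground I H D S) (hSconst : ¬ ∃ c, ∀ z ∈ I 3, S z = c) {P : Pt}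
    (hP : P ∈ Set.univ.pi I) :
    Module.finrank ℝ (godelMotions (Set.univ.pi I) H D S) = 4 := by
  have := (LinearEquiv.ofBijective
    (motionJet hP : godelMotions (Set.univ.pi I) H D S →ₗ[ℝ] (Fin 4 → ℝ))
    ⟨K.motionJet_injective B hSconst hP, K.motionJet_surjective B hP⟩).finrank_eq
  rw [Module.finrank_fin_fun] at this
  exact this

/-- A motion vanishing at $P$ has only the last jet coordinate free, so by injectivity it is that
multiple of the rotation. -/
theorem finrank_isotropy (K : IsHomogeneousProfile (I 1) H D k)
    (B : IsGodelBackground I H D S) (hSconst : ¬ ∃ c, ∀ z ∈ I 3, S z = c) {P : Pt}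
    (hP : P ∈ Set.univ.pi I) :
    Module.finrank ℝ (isotropy (godelMotions (Set.univ.pi I) H D S) P) = 1 := by
  obtain ⟨η, hη, hηv, hη'⟩ := K.exists_rotation B hP
  have hη0 : η ≠ 0 := by
    rintro rfl
    simp at hη'
  have e : isotropy (godelMotions (Set.univ.pi I) H D S) P = ℝ ∙ η := by
    ext ξ
    rw [mem_isotropy, Submodule.mem_span_singleton]
    constructor
    · rintro ⟨hξ, hξP⟩
      refine ⟨pd 2 (fun q => ξ q 1) P, ?_⟩
      let η' : godelMotions (Set.univ.pi I) H D S := ⟨η, hη⟩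
      let ξ' : godelMotions (Set.univ.pi I) H D S := ⟨ξ, hξ⟩
      have : pd 2 (fun q => ξ q 1) P • η' = ξ' := by
        refine K.motionJet_injective B hSconst hP ?_
        rw [map_smul]
        simp [motionJet, η', ξ', hηv, hη', hξP]
      exact congrArg Subtype.val this
    · rintro ⟨a, rfl⟩
      exact ⟨Submodule.smul_mem _ a hη, by simp [hηv]⟩
  rw [e, finrank_span_singleton hη0]

/-- The inclusion of the `(t, x, y)`-directions into the tangent space. -/
def sliceInclusion : (Fin 3 → ℝ) →ₗ[ℝ] Pt where
  toFun v := ![v 0, v 1, v 2, 0]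
  map_add' v w := by
    ext i
    revert i
    simp [forall_fin_four]
  map_smul' r v := by
    ext i
    revert i
    simp [forall_fin_four]

theorem finrank_orbitTangent (K : IsHomogeneousProfile (I 1) H D k)
    (B : IsGodelBackground I H D S) (hSconst : ¬ ∃ c, ∀ z ∈ I 3, S z = c) {P : Pt}
    (hP : P ∈ Set.univ.pi I) :
    Module.finrank ℝ (orbitTangent (godelMotions (Set.univ.pi I) H D S) P) = 3 := by
  have hinj : Function.Injective sliceInclusion := fun v w hvw => by
    ext i
    fin_cases i
    · exact congrFun hvw 0
    · exact congrFun hvw 1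
    · exact congrFun hvw 2
  have e : orbitTangent (godelMotions (Set.univ.pi I) H D S) P =
      LinearMap.range sliceInclusion := by
    ext v
    simp only [orbitTangent, Submodule.mem_map, LinearMap.mem_range, LinearMap.proj_apply]
    constructor
    · rintro ⟨ξ, hξ, rfl⟩
      refine ⟨![ξ P 0, ξ P 1, ξ P 2], ?_⟩
      ext i
      revert i
      simp [forall_fin_four, sliceInclusion, B.apply_three_eq_zero hSconst hξ hP]
    · rintro ⟨v, rfl⟩
      obtain ⟨ξ, hξ⟩ := K.motionJet_surjective B hP ![v 0, v 1, v 2, 0]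
      refine ⟨ξ.1, ξ.2, ?_⟩
      ext i
      revert i
      exact forall_fin_four.2 ⟨congrFun hξ 0, congrFun hξ 1, congrFun hξ 2,
        B.apply_three_eq_zero hSconst ξ.2 hP⟩
  rw [e, LinearMap.finrank_range_of_inj hinj, Module.finrank_fin_fun]

end IsHomogeneousProfile

end

/-! ### Orbits -/

section

variable {I : Fin 4 → Set ℝ} {H D S : ℝ → ℝ} {ξ : Pt → Pt} {k : ℝ}

/-- A component that vanishes for every motion has zero derivative along every flow line. It is used
with $a=3$ to keep orbits inside $z$-slices. -/
theorem FlowsTo.apply_eq {M : Set Pt} {G : Submodule ℝ (Pt → Pt)} {a : Fin 4}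
    (hG : ∀ ξ ∈ G, ∀ q ∈ M, ξ q a = 0) {p q : Pt} (h : FlowsTo M G p q) :
    q ∈ M ∧ q a = p a := by
  obtain ⟨ξ, hξ, γ, rfl, rfl, hγ⟩ := h
  have h1 : (1 : ℝ) ∈ Set.Icc (0 : ℝ) 1 := by simp
  have h0 : (0 : ℝ) ∈ Set.Icc (0 : ℝ) 1 := by simp
  refine ⟨(hγ 1 h1).1, ?_⟩
  have := (convex_Icc (0 : ℝ) 1).norm_image_sub_le_of_norm_hasDerivWithin_le (C := 0)
    (f := fun s => γ s a) (f' := fun s => ξ (γ s) a)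
    (fun s hs => hasDerivWithinAt_pi.1 (hγ s hs).2 a)
    (fun s hs => by simp [hG ξ hξ _ (hγ s hs).1]) h0 h1
  rwa [zero_mul, norm_le_zero_iff, sub_eq_zero] at this

/-- A motion equal to `∂ᵢ` along the `i`-th coordinate line through `p` moves `p` along it. -/
theorem flowsTo_update (hconn : ∀ i, (I i).OrdConnected) {G : Submodule ℝ (Pt → Pt)}
    (hξ : ξ ∈ G) {p : Pt} (hp : p ∈ Set.univ.pi I) {i : Fin 4}
    (h : ∀ s ∈ I i, ξ (update p i s) = Pi.single i 1) {r : ℝ} (hr : r ∈ I i) :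
    FlowsTo (Set.univ.pi I) G p (update p i r) := by
  have hmem : ∀ s ∈ Set.Icc (0 : ℝ) 1, p i + s * (r - p i) ∈ I i := fun s hs => by
    have := (hconn i).convex (hp i trivial) hr (sub_nonneg.2 hs.2) hs.1 (by ring)
    convert this using 1
    simp only [smul_eq_mul]
    ring
  refine ⟨(r - p i) • ξ, Submodule.smul_mem _ _ hξ, fun s => update p i (p i + s * (r - p i)),
    by simp, by simp, fun s hs => ⟨update_mem_box hp (hmem s hs), ?_⟩⟩
  have hl : HasDerivAt (fun s => p i + s * (r - p i)) (r - p i) s := by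
    simpa using ((hasDerivAt_id s).mul_const (r - p i)).const_add (p i)
  refine ((_root_.hasDerivAt_update p i _).scomp s hl).hasDerivWithinAt.congr_deriv ?_
  rw [Pi.smul_apply, h _ (hmem s hs)]

theorem IsHomogeneousProfile.orbit_eq (K : IsHomogeneousProfile (I 1) H D k)
    (B : IsGodelBackground I H D S) (hSconst : ¬ ∃ c, ∀ z ∈ I 3, S z = c) {P : Pt}
    (hP : P ∈ Set.univ.pi I) :
    orbit (Set.univ.pi I) (godelMotions (Set.univ.pi I) H D S) P
      = {Q | Q ∈ Set.univ.pi I ∧ Q 3 = P 3} := by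
  ext Q
  constructor
  · intro h
    induction h with
    | refl => exact ⟨hP, rfl⟩
    | tail _ h ih =>
      obtain ⟨h1, h2⟩ := FlowsTo.apply_eq
        (fun ξ hξ q hq => B.apply_three_eq_zero hSconst hξ hq) h
      exact ⟨h1, h2.trans ih.2⟩
  · rintro ⟨hQ, h3⟩
    -- The $x$-move comes first, since the transvection is known to equal $\partial_x$ only on
    -- $y=y_P$; $\partial_y$ and $\partial_t$ are available everywhere and complete the path.
    obtain ⟨ξ, hξ, hξP, -⟩ := K.exists_transvection B hP
    have hp1 := update_mem_box hP (hQ 1 trivial)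
    have hp2 := update_mem_box hp1 (hQ 2 trivial)
    have e : Q = update (update (update P 1 (Q 1)) 2 (Q 2)) 0 (Q 0) := by
      ext i
      revert i
      simp [forall_fin_four, update, h3]
    have s1 : FlowsTo (Set.univ.pi I) (godelMotions (Set.univ.pi I) H D S) P
        (update P 1 (Q 1)) := flowsTo_update B.ordConnected hξ hP (fun s hs => by
      rw [hξP _ (update_mem_box hP hs) (by simp [update])]
      ext i
      revert i
      simp [forall_fin_four]) (hQ 1 trivial)
    have s2 : FlowsTo (Set.univ.pi I) (godelMotions (Set.univ.pi I) H D S) (update P 1 (Q 1))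
        (update (update P 1 (Q 1)) 2 (Q 2)) := flowsTo_update B.ordConnected
      ((isGodelField_translationField B.isOpen ![0, 1]).mem_godelMotions B) hp1 (fun s hs => by
        rw [translationField_apply _ (update_mem_box hp1 hs)]
        ext i
        revert i
        simp [forall_fin_four]) (hQ 2 trivial)
    have s3 : FlowsTo (Set.univ.pi I) (godelMotions (Set.univ.pi I) H D S)
        (update (update P 1 (Q 1)) 2 (Q 2))
        (update (update (update P 1 (Q 1)) 2 (Q 2)) 0 (Q 0)) := flowsTo_update B.ordConnected
      ((isGodelField_translationField B.isOpen ![1, 0]).mem_godelMotions B) hp2 (fun s hs => by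
        rw [translationField_apply _ (update_mem_box hp2 hs)]
        ext i
        revert i
        simp [forall_fin_four]) (hQ 0 trivial)
    change Relation.ReflTransGen _ P Q
    rw [e]
    exact ((Relation.ReflTransGen.single s1).tail s2).tail s3

/-- If one slice were all of $M$, then $z$ would take a single value and $S$ would be constant. -/
theorem IsHomogeneousProfile.not_isSTHomogeneous (K : IsHomogeneousProfile (I 1) H D k)
    (B : IsGodelBackground I H D S) (hSconst : ¬ ∃ c, ∀ z ∈ I 3, S z = c) {P : Pt}
    (hP : P ∈ Set.univ.pi I) :
    ¬ IsSTHomogeneous (Set.univ.pi I) (godelMotions (Set.univ.pi I) H D S) := by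
  intro hom
  refine hSconst ⟨S (P 3), fun z hz => ?_⟩
  have hQ := update_mem_box hP hz
  rw [← hom P hP, K.orbit_eq B hSconst hP] at hQ
  have : z = P 3 := by simpa using hQ.2
  rw [this]

end

end RiemannCartan

theorem mainTheorem3
    (I : Fin 4 → Set ℝ)
    (hopen : ∀ i, IsOpen (I i)) (hconn : ∀ i, (I i).OrdConnected) (hne : ∀ i, (I i).Nonempty)
    (H D S : ℝ → ℝ)
    (hH : ContDiffOn ℝ ∞ H (I 1)) (hD : ContDiffOn ℝ ∞ D (I 1)) (hS : ContDiffOn ℝ ∞ S (I 3))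
    (hD0 : ∀ x ∈ I 1, D x ≠ 0)
    (hSconst : ¬ ∃ c, ∀ z ∈ I 3, S z = c) :
    (¬ ((∃ c, ∀ x ∈ I 1, deriv H x / D x = c) ∧
          (∃ c, ∀ x ∈ I 1, deriv (deriv D) x / D x = c)) →
      Module.finrank ℝ (godelMotions (Set.univ.pi I) H D S) = 2 ∧
      ∀ P ∈ Set.univ.pi I,
        Module.finrank ℝ (isotropy (godelMotions (Set.univ.pi I) H D S) P) = 0) ∧
    (∀ w m2 : ℝ,
      (∀ x ∈ I 1, deriv H x / D x = 2 * w) →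
      (∀ x ∈ I 1, deriv (deriv D) x / D x = m2) →
      Module.finrank ℝ (godelMotions (Set.univ.pi I) H D S) = 4 ∧
      (∀ P ∈ Set.univ.pi I,
        Module.finrank ℝ (isotropy (godelMotions (Set.univ.pi I) H D S) P) = 1 ∧
        Module.finrank ℝ (orbitTangent (godelMotions (Set.univ.pi I) H D S) P) = 3 ∧
        orbit (Set.univ.pi I) (godelMotions (Set.univ.pi I) H D S) P
          = {Q | Q ∈ Set.univ.pi I ∧ Q 3 = P 3}) ∧
      ¬ IsSTHomogeneous (Set.univ.pi I) (godelMotions (Set.univ.pi I) H D S)) := by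
  have B : IsGodelBackground I H D S := ⟨hopen, hconn, hH, hD, hS, hD0⟩
  choose P₀ hP₀ using hne
  have hP₀' : P₀ ∈ Set.univ.pi I := fun i _ => hP₀ i
  refine ⟨fun hgen => ⟨finrank_godelMotions_generic B hSconst hP₀' hgen, fun P hP => ?_⟩,
    fun w m2 hw hm => ?_⟩
  · rw [isotropy_eq_bot_generic B hSconst hP hgen, finrank_bot]
  · obtain ⟨k, K⟩ := exists_isHomogeneousProfile B (hP₀ 1) hw hm
    exact ⟨K.finrank_godelMotions B hSconst hP₀', fun P hP => ⟨K.finrank_isotropy B hSconst hP,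
      K.finrank_orbitTangent B hSconst hP, K.orbit_eq B hSconst hP⟩,
      K.not_isSTHomogeneous B hSconst hP₀'⟩
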